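/- A partition $\lambda=(\lambda_1\ge\lambda_2\ge\cdots)$ (possibly empty) is identified with its Ferris--Young diagram, and the hook number of a node is the number of nodes directly to its right or directly below it, counting the node itself. For a positive integer $t$, a partition is a $t$-core if none of its hook numbers is divisible by $t$. For $n\ge 0$ let $A_5(n)$ be the number of ordered pairs $(\lambda,\mu)$ of partitions that are both $5$-cores and whose parts, taken together, have sum $n$. Let $\{B_k\}_{k\ge 0}$ be the integer sequence defined by $B_0=0$, $B_1=1$ and $$B_k=-4B_{k-1}-8B_{k-2}+\frac{8^k-1}{7}\qquad(k\ge 2).$$ Theorem 1.2. For all integers $n\ge 0$ and $k\ge 1$, $$A_5\bigl(2^{k+1}n+3\cdot 2^k-2\bigr)=B_k\,A_5(4n+4)+\Bigl(\frac{8^{k+1}-1}{7}-9B_k\Bigr)A_5(2n+1).$$ Moreover, for all $m\ge 0$, the number $\frac{8^{4m+4}-1}{91}$ is an integer and $B_{4m+3}=\frac{8^{4m+4}-1}{91}$. Consequently, for all integers $m\ge 0$ and $n\ge 0$, $$A_5\bigl(2^{4m+4}n+3\cdot 2^{4m+3}-2\bigr)\equiv 0 \pmod{\frac{8^{4m+4}-1}{91}}.$$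 -/

import Mathlib

namespace CorePairs

/-- The hook number of the node `(i, j)` of a partition, given as its Young diagram: the nodes of
row `i` strictly to the right, the nodes of column `j` strictly below, and the node itself. -/
def hookNumber (μ : YoungDiagram) (i j : ℕ) : ℕ :=
  (μ.rowLen i - (j + 1)) + (μ.colLen j - (i + 1)) + 1

/-- A partition is a `t`-core if none of its hook numbers is divisible by `t`. -/
def IsCore (t : ℕ) (μ : YoungDiagram) : Prop :=
  ∀ i j : ℕ, (i, j) ∈ μ → ¬ t ∣ hookNumber μ i j

/-- The partition pairs of `n` with `t`-cores. -/
def corePairs (t n : ℕ) : Set (YoungDiagram × YoungDiagram) :=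
  {p | IsCore t p.1 ∧ IsCore t p.2 ∧ p.1.card + p.2.card = n}

/-- There are finitely many partitions of numbers up to `n`. -/
theorem finite_card_le (n : ℕ) : {μ : YoungDiagram | μ.card ≤ n}.Finite := by
  refine Set.Finite.of_finite_image (f := YoungDiagram.cells)
    ((Finset.finite_toSet (Finset.powerset (Finset.range n ×ˢ Finset.range n))).subset ?_)
    (fun μ _ ν _ h => YoungDiagram.ext h)
  rintro _ ⟨μ, hμ, rfl⟩
  simp only [Finset.coe_powerset, Set.mem_preimage, Set.mem_powerset_iff, Finset.coe_subset]
  rintro ⟨i, j⟩ hc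
  have hμ' : μ.cells.card ≤ n := hμ
  have hc' : (i, j) ∈ μ := hc
  have h1 : j < (μ.row i).card := by
    rw [← YoungDiagram.rowLen_eq_card]; exact YoungDiagram.mem_iff_lt_rowLen.1 hc'
  have h2 : i < (μ.col j).card := by
    rw [← YoungDiagram.colLen_eq_card]; exact YoungDiagram.mem_iff_lt_colLen.1 hc'
  have h3 : (μ.row i).card ≤ μ.cells.card := Finset.card_filter_le _ _
  have h4 : (μ.col j).card ≤ μ.cells.card := Finset.card_filter_le _ _
  simp only [Finset.mem_product, Finset.mem_range]
  omega

/-- The set counted by `A` is finite, so that `A` is its true number of elements. -/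
theorem finite_corePairs (t n : ℕ) : (corePairs t n).Finite := by
  refine ((finite_card_le n).prod (finite_card_le n)).subset ?_
  rintro ⟨μ, ν⟩ ⟨-, -, h⟩
  simp only at h
  simp only [Set.mem_prod, Set.mem_ofPred_eq]
  omega

/-- `A t n` is the number of partition pairs of `n` with `t`-cores. -/
noncomputable def A (t n : ℕ) : ℕ := (corePairs t n).ncard

/-- The sequence `B_0 = 0`, `B_1 = 1`, `B_k = -4 B_{k-1} - 8 B_{k-2} + (8^k - 1) / 7` for `k ≥ 2`.
The division of integers is exact, see `seven_dvd`. -/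
def B : ℕ → ℤ
  | 0 => 0
  | 1 => 1
  | k + 2 => -4 * B (k + 1) - 8 * B k + (8 ^ (k + 2) - 1) / 7

theorem seven_dvd (k : ℕ) : (7 : ℤ) ∣ 8 ^ k - 1 := by
  simpa using (sub_dvd_pow_sub_pow (8 : ℤ) 1 k)

end CorePairs

/-! Write E(k) for `eulerProd k`. On an abacus with t runners, t-cores are the bead sets in which
every runner is filled from the bottom; this gives the generating function C = E(5)^5 / E(1) for
5-cores (`eulerProd_one_mul_coreSeries`). Hence F = (qC)^2 has coefficient A_5(n) at n + 2. It is a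
form of weight 4 and level 5, and so is the cusp form S = q E(1)^4 E(5)^4. Let U keep the
even-indexed coefficients and halve their indices, and let V be q ↦ q^2. The heart of the proof is
`even_parts_coreSeries`: U F = 9F + S - 8 V F and U S = -4S - 8 V S.

No theory of modular forms is used. Two theta identities, proved by splitting a sum over ℤ² modulo a
prime of ℤ[i] above 5, express 1 - 4g and 1 + g as eta quotients, where g = q E(1) E(10)^5 / (E(2)
E(5)^5). With h = g(-q) and c = g(q^2) they give gh = -c and (1 - 4g)(1 - 4h) = (1 - 4c)^2, hence g
+ h as a polynomial in c. After division by the square of V(qC), F and S are rational functions of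
g, so their even parts are symmetric functions of g and h, computed in terms of c.

Along the indices 2^k (2n + 3) this gives linear recurrences. The combination S + 13F has eigenvalue
9 = 1 + 8, so its values are multiples of (8^(k+1) - 1) / 7. Eliminating S leaves for F the
recurrence that defines `B` (`eq_B_mul_add`). The homogeneous part of that recurrence has roots -2 ±
2i, with fourth power -64, which explains the period four in the divisibility statement
(`ninetyone_mul_B`). -/

namespace CorePairs
open PowerSeries Filter Topology
open scoped PowerSeries.WithPiTopology

/-! ### Finite q-products and Gaussian binomials. -/

/-- The finite product `∏_{1 ≤ i ≤ n} (1 - q ^ i)`. -/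
def qPochhammer {R : Type*} [CommRing R] (q : R) (n : ℕ) : R :=
  ∏ i ∈ Finset.range n, (1 - q ^ (i + 1))

theorem qPochhammer_succ {R : Type*} [CommRing R] (q : R) (n : ℕ) :
    qPochhammer q (n + 1) = qPochhammer q n * (1 - q ^ (n + 1)) :=
  Finset.prod_range_succ _ _

theorem map_qPochhammer {R S : Type*} [CommRing R] [CommRing S] (f : R →+* S) (q : R) (n : ℕ) :
    f (qPochhammer q n) = qPochhammer (f q) n := by
  simp [qPochhammer]

/-- The Gaussian binomial coefficient, as a polynomial in `q`. -/
def gaussBinom {R : Type*} [CommRing R] (q : R) : ℕ → ℕ → R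
  | _, 0 => 1
  | 0, _ + 1 => 0
  | n + 1, k + 1 => q ^ (k + 1) * gaussBinom q n (k + 1) + gaussBinom q n k

section gaussBinom

variable {R : Type*} [CommRing R] (q : R)

@[simp] theorem gaussBinom_zero_right (n : ℕ) : gaussBinom q n 0 = 1 := by
  cases n <;> rfl

@[simp] theorem gaussBinom_zero_succ (k : ℕ) : gaussBinom q 0 (k + 1) = 0 := rfl

theorem gaussBinom_succ_succ (n k : ℕ) :
    gaussBinom q (n + 1) (k + 1) = q ^ (k + 1) * gaussBinom q n (k + 1) + gaussBinom q n k := rfl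

theorem gaussBinom_eq_zero {n k : ℕ} (h : n < k) : gaussBinom q n k = 0 := by
  induction n generalizing k with
  | zero => obtain ⟨k, rfl⟩ := Nat.exists_eq_succ_of_ne_zero h.ne'; rfl
  | succ n ih =>
    obtain ⟨k, rfl⟩ := Nat.exists_eq_succ_of_ne_zero (by omega : k ≠ 0)
    rw [Nat.succ_eq_add_one, gaussBinom_succ_succ, ih (by omega), ih (by omega)]
    simp

/-- The `q`-binomial theorem. -/
theorem prod_add_mul_pow (y z : R) (n : ℕ) :
    ∏ i ∈ Finset.range n, (y + z * q ^ i) =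
      ∑ k ∈ Finset.range (n + 1), gaussBinom q n k * q ^ (k.choose 2) * z ^ k * y ^ (n - k) := by
  induction n generalizing z with
  | zero => simp
  | succ n ih =>
    have h1 : ∏ i ∈ Finset.range (n + 1), (y + z * q ^ i) =
        (y + z) * ∏ i ∈ Finset.range n, (y + (z * q) * q ^ i) := by
      rw [Finset.prod_range_succ', pow_zero, mul_one, mul_comm]
      congr 1
      exact Finset.prod_congr rfl fun i _ => by ring
    have h2 : ∀ k ∈ Finset.range (n + 1),
        y * (gaussBinom q n k * q ^ (k.choose 2) * (z * q) ^ k * y ^ (n - k)) =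
        gaussBinom q n k * q ^ (k.choose 2 + k) * z ^ k * y ^ (n + 1 - k) := by
      intro k hk
      rw [Nat.sub_add_comm (Finset.mem_range_succ_iff.1 hk)]
      ring
    have h3 : ∑ k ∈ Finset.range (n + 1),
          gaussBinom q n k * q ^ (k.choose 2 + k) * z ^ k * y ^ (n + 1 - k) =
        ∑ k ∈ Finset.range (n + 1), gaussBinom q n (k + 1) * q ^ ((k + 1).choose 2 + (k + 1))
          * z ^ (k + 1) * y ^ (n - k) + y ^ (n + 1) := by
      have := Finset.sum_range_succ' (fun k => gaussBinom q n k * q ^ (k.choose 2 + k) * z ^ k *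
        y ^ (n + 1 - k)) (n + 1)
      rw [Finset.sum_range_succ, gaussBinom_eq_zero q (Nat.lt_succ_self n)] at this
      simpa using this
    rw [h1, ih, add_mul, Finset.mul_sum, Finset.sum_congr rfl h2, h3, Finset.mul_sum,
      Finset.sum_range_succ' _ (n + 1), add_right_comm, ← Finset.sum_add_distrib]
    congr 1
    · refine Finset.sum_congr rfl fun k _ => ?_
      rw [gaussBinom_succ_succ, Nat.succ_sub_succ, Nat.choose_succ_succ' k 1, Nat.choose_one_right]
      ring
    · simp

/-- The quotient formula for Gaussian binomials, kept free of division so that it holds in every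
commutative ring. -/
theorem gaussBinom_mul_qPochhammer (m k : ℕ) :
    gaussBinom q (m + k) k * qPochhammer q k * qPochhammer q m = qPochhammer q (m + k) := by
  induction m generalizing k with
  | zero =>
    induction k with
    | zero => simp [qPochhammer]
    | succ k ih =>
      rw [zero_add] at ih
      rw [zero_add, gaussBinom_succ_succ, gaussBinom_eq_zero q (Nat.lt_succ_self k),
        qPochhammer_succ]
      linear_combination (1 - q ^ (k + 1)) * ih
  | succ m ihm =>
    induction k with
    | zero => simp [qPochhammer]
    | succ k ih =>
      have h1 := ihm (k + 1)
      rw [← add_assoc, gaussBinom_succ_succ, qPochhammer_succ]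
      rw [qPochhammer_succ q m] at ih ⊢
      have e : m + 1 + k = m + (k + 1) := by ring
      rw [e] at ih ⊢
      rw [qPochhammer_succ] at h1 ⊢
      linear_combination (1 - q ^ (k + 1)) * ih + (1 - q ^ (m + 1)) * q ^ (k + 1) * h1

theorem map_gaussBinom {S : Type*} [CommRing S] (f : R →+* S) (n k : ℕ) :
    f (gaussBinom q n k) = gaussBinom (f q) n k := by
  induction n generalizing k with
  | zero => cases k <;> simp
  | succ n ih => cases k <;> simp [gaussBinom_succ_succ, ih]

end gaussBinom

/-! ### Euler products and their truncations. -/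

/-- The power series `∏_{i ≥ 1} (1 - X ^ (k * i))`. -/
noncomputable def eulerProd (k : ℕ) : ℤ⟦X⟧ :=
  PowerSeries.mk fun n => coeff n (qPochhammer ((X : ℤ⟦X⟧) ^ k) n)

/-- Factors beyond the `n`-th are `1` modulo `X ^ (n + 1)`, so coefficients stabilise. This is why
`eulerProd` may read its coefficient `n` off the `n`-th truncation. -/
theorem X_pow_dvd_qPochhammer_sub {k : ℕ} (hk : 1 ≤ k) {n m : ℕ} (h : n ≤ m) :
    (X : ℤ⟦X⟧) ^ (n + 1) ∣ qPochhammer ((X : ℤ⟦X⟧) ^ k) m - qPochhammer (X ^ k) n := by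
  induction m, h using Nat.le_induction with
  | base => simp
  | succ m h ih =>
    have : qPochhammer ((X : ℤ⟦X⟧) ^ k) (m + 1) - qPochhammer (X ^ k) n =
        (qPochhammer ((X : ℤ⟦X⟧) ^ k) m - qPochhammer (X ^ k) n) -
          X ^ (k * (m + 1)) * qPochhammer ((X : ℤ⟦X⟧) ^ k) m := by
      rw [qPochhammer_succ]; ring
    rw [this]
    exact dvd_sub ih (dvd_mul_of_dvd_left (pow_dvd_pow _ (by nlinarith)) _)

theorem X_pow_dvd_eulerProd_sub {k : ℕ} (hk : 1 ≤ k) (n : ℕ) :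
    (X : ℤ⟦X⟧) ^ (n + 1) ∣ eulerProd k - qPochhammer (X ^ k) n := by
  rw [X_pow_dvd_iff]
  intro d hd
  have h := X_pow_dvd_iff.1 (X_pow_dvd_qPochhammer_sub hk (Nat.lt_succ_iff.1 hd)) d
    (Nat.lt_succ_self d)
  rw [map_sub, sub_eq_zero] at h ⊢
  rw [eulerProd, coeff_mk, h]

theorem eq_of_X_pow_dvd_sub {f g : ℤ⟦X⟧} (h : ∀ n, X ^ n ∣ f - g) : f = g := by
  ext d
  have := X_pow_dvd_iff.1 (h (d + 1)) d (Nat.lt_succ_self d)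
  rwa [map_sub, sub_eq_zero] at this

theorem tendsto_of_X_pow_dvd_sub {s : ℕ → ℤ⟦X⟧} {f : ℤ⟦X⟧} (h : ∀ n, X ^ n ∣ s n - f) :
    Tendsto s atTop (𝓝 f) := by
  rw [PowerSeries.WithPiTopology.tendsto_iff_coeff_tendsto]
  intro d
  refine tendsto_const_nhds.congr' ?_
  filter_upwards [eventually_gt_atTop d] with n hn
  have := X_pow_dvd_iff.1 (h n) d hn
  rw [map_sub, sub_eq_zero] at this
  exact this.symm

theorem tendsto_qPochhammer {k : ℕ} (hk : 1 ≤ k) :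
    Tendsto (fun n => qPochhammer ((X : ℤ⟦X⟧) ^ k) n) atTop (𝓝 (eulerProd k)) :=
  tendsto_of_X_pow_dvd_sub fun n => by
    rw [dvd_sub_comm]
    exact (pow_dvd_pow _ n.le_succ).trans (X_pow_dvd_eulerProd_sub hk n)

theorem constantCoeff_eulerProd (k : ℕ) : constantCoeff (eulerProd k) = 1 := by
  rw [← coeff_zero_eq_constantCoeff_apply, eulerProd, coeff_mk]
  simp [qPochhammer]

theorem isUnit_eulerProd (k : ℕ) : IsUnit (eulerProd k) := by
  rw [PowerSeries.isUnit_iff_constantCoeff, constantCoeff_eulerProd]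
  exact isUnit_one

theorem eulerProd_ne_zero (k : ℕ) : eulerProd k ≠ 0 := (isUnit_eulerProd k).ne_zero

/-- The three q-factorials in the quotient formula all agree with the Euler product up to order `min
m l`, so a Gaussian binomial far from both ends approximates its inverse. Both the triple product
and the core generating function rest on this. -/
theorem X_pow_dvd_eulerProd_mul_gaussBinom_sub_one {k : ℕ} (hk : 1 ≤ k) (m l : ℕ) :
    (X : ℤ⟦X⟧) ^ (min m l + 1) ∣ eulerProd k * gaussBinom (X ^ k) (m + l) l - 1 := by
  have h := gaussBinom_mul_qPochhammer ((X : ℤ⟦X⟧) ^ k) m l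
  have key : ∀ n, min m l ≤ n →
      (X : ℤ⟦X⟧) ^ (min m l + 1) ∣ eulerProd k - qPochhammer (X ^ k) n := fun n hn =>
    (pow_dvd_pow _ (by omega)).trans (X_pow_dvd_eulerProd_sub hk n)
  obtain ⟨a, ha⟩ := key m (min_le_left _ _)
  obtain ⟨b, hb⟩ := key l (min_le_right _ _)
  obtain ⟨c, hc⟩ := key (m + l) (by omega)
  rw [← (isUnit_eulerProd k).dvd_mul_left]
  refine ⟨gaussBinom (X ^ k) (m + l) l * (a * eulerProd k + qPochhammer (X ^ k) m * b) - c, ?_⟩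
  linear_combination (gaussBinom (X ^ k) (m + l) l) * (eulerProd k) * ha
    + gaussBinom (X ^ k) (m + l) l * (qPochhammer (X ^ k) m) * hb - hc + h

/-! ### Generating series of weighted families. -/

/-- The generating function `∑ i, X ^ w i` of a family of natural numbers with finite fibres. -/
noncomputable def genSeries {ι : Type*} (w : ι → ℕ) : ℤ⟦X⟧ :=
  PowerSeries.mk fun n => (Nat.card {i // w i = n} : ℤ)

section genSeries

variable {ι κ : Type*}

/-- Turns a change of summation variables into an identity of series, with no question of
convergence. -/
theorem genSeries_congr {w : ι → ℕ} {v : κ → ℕ} (e : ι ≃ κ) (h : ∀ i, w i = v (e i)) :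
    genSeries w = genSeries v := by
  ext n
  simp only [genSeries, coeff_mk]
  congr 1
  exact Nat.card_congr (e.subtypeEquiv fun i => by rw [h])

theorem genSeries_mul {w : ι → ℕ} {v : κ → ℕ} (hw : ∀ n, Finite {i // w i = n})
    (hv : ∀ n, Finite {i // v i = n}) :
    genSeries w * genSeries v = genSeries fun p : ι × κ => w p.1 + v p.2 := by
  ext n
  simp only [genSeries, coeff_mul, coeff_mk]
  let e : {p : ι × κ // w p.1 + v p.2 = n} ≃
      Σ a : {a : ℕ × ℕ // a ∈ Finset.HasAntidiagonal.antidiagonal n}, {i // w i = a.1.1} × {i // v i = a.1.2} :=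
    { toFun := fun p => ⟨⟨(w p.1.1, v p.1.2), Finset.HasAntidiagonal.mem_antidiagonal.2 p.2⟩,
        ⟨p.1.1, rfl⟩, ⟨p.1.2, rfl⟩⟩
      invFun := fun s => ⟨(s.2.1.1, s.2.2.1), by
        rw [s.2.1.2, s.2.2.2]; exact Finset.HasAntidiagonal.mem_antidiagonal.1 s.1.2⟩
      left_inv := fun p => rfl
      right_inv := by
        rintro ⟨⟨⟨a, b⟩, h⟩, ⟨i, hi⟩, ⟨j, hj⟩⟩
        dsimp only at hi hj
        subst hi hj
        rfl }
  rw [Nat.card_congr e, Nat.card_sigma]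
  simp only [Nat.card_prod]
  rw [Finset.univ_eq_attach, Finset.sum_attach (Finset.HasAntidiagonal.antidiagonal n)
    (fun a => Nat.card {i // w i = a.1} * Nat.card {i // v i = a.2})]
  push_cast
  rfl

theorem X_pow_mul_genSeries (w : ι → ℕ) (k : ℕ) :
    X ^ k * genSeries w = genSeries fun i => w i + k := by
  ext n
  rw [coeff_X_pow_mul']
  simp only [genSeries, coeff_mk]
  split_ifs with h
  · congr 1
    exact Nat.card_congr (Equiv.subtypeEquivRight fun i => by omega)
  · have : IsEmpty {i // w i + k = n} := ⟨fun i => by have := i.2; omega⟩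
    simp

theorem genSeries_eq_sum {w : ι → ℕ} (hw : ∀ n, Finite {i // w i = n}) [Fintype κ] (f : ι → κ) :
    genSeries w = ∑ c, genSeries fun i : {i // f i = c} => w i := by
  ext n
  rw [map_sum]
  simp only [genSeries, coeff_mk]
  let e : {i // w i = n} ≃ Σ c, {i : {i // f i = c} // w i = n} :=
    { toFun := fun i => ⟨f i, ⟨i, rfl⟩, i.2⟩
      invFun := fun s => ⟨s.2.1.1, s.2.2⟩
      left_inv := fun _ => rfl
      right_inv := by rintro ⟨_, ⟨i, rfl⟩, h⟩; rfl }
  have : ∀ c, Finite {i : {i // f i = c} // w i = n} := fun c =>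
    Finite.of_injective (fun i => (⟨i.1.1, i.2⟩ : {i // w i = n})) fun i j h => by
      simpa [Subtype.ext_iff] using h
  rw [Nat.card_congr e, Nat.card_sigma]
  push_cast
  rfl

end genSeries

/-! ### Theta functions and the Jacobi triple product. -/

/-- The triangular number `m (m + 1) / 2` of an integer `m`. -/
def tri (m : ℤ) : ℕ := (m * (m + 1) / 2).toNat

theorem two_mul_tri (m : ℤ) : 2 * (tri m : ℤ) = m * (m + 1) := by
  have h : 2 ∣ m * (m + 1) := (Int.even_mul_succ_self m).two_dvd
  have h0 : 0 ≤ m * (m + 1) := by nlinarith [sq_nonneg (2 * m + 1)]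
  rw [tri, Int.toNat_of_nonneg (Int.ediv_nonneg h0 (by norm_num)), Int.mul_ediv_cancel' h]

/-- The exponents in the theta function `∑ m, a ^ (m (m + 1) / 2) * b ^ (m (m - 1) / 2)` at
`a = X ^ r` and `b = X ^ s`. -/
def thetaExp (r s : ℕ) (m : ℤ) : ℕ := r * tri m + s * tri (-m)

theorem two_mul_thetaExp (r s : ℕ) (m : ℤ) :
    2 * (thetaExp r s m : ℤ) = r * (m * (m + 1)) + s * (m * (m - 1)) := by
  have h1 := two_mul_tri m
  have h2 := two_mul_tri (-m)
  rw [thetaExp]; push_cast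
  linear_combination (r : ℤ) * h1 + (s : ℤ) * h2

/-- Linear growth is enough: it makes the fibres finite, and it places every exponent below `n` in
the window `|m| ≤ n`. -/
theorem natAbs_le_thetaExp {r s : ℕ} (h : 1 ≤ r + s) (m : ℤ) : m.natAbs ≤ thetaExp r s m + 1 := by
  have key : ∀ m : ℤ, m.natAbs ≤ tri m + 1 := fun m => by
    have h1 := two_mul_tri m
    zify
    rcases abs_cases m with ⟨h, h'⟩ | ⟨h, h'⟩ <;> rw [h] <;> nlinarith [sq_nonneg (m - 1)]
  have h1 := key m
  have h2 := key (-m)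
  rw [Int.natAbs_neg] at h2
  rw [thetaExp]
  rcases Nat.eq_zero_or_pos r with rfl | hr
  · nlinarith
  · nlinarith

theorem finite_thetaExp {r s : ℕ} (h : 1 ≤ r + s) (n : ℕ) : Finite {m // thetaExp r s m = n} := by
  refine Set.Finite.subset (Set.finite_Icc (-(n + 1 : ℤ)) (n + 1)) fun m hm => ?_
  have := natAbs_le_thetaExp h m
  have hm : thetaExp r s m = n := hm
  simp only [Set.mem_Icc]
  omega

/-- Ramanujan's theta function `f (X ^ r, X ^ s)`. -/
noncomputable def theta (r s : ℕ) : ℤ⟦X⟧ := genSeries (thetaExp r s)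

theorem X_pow_dvd_sum_sub_theta {r s : ℕ} (h : 1 ≤ r + s) (n : ℕ) :
    (X : ℤ⟦X⟧) ^ n ∣
      ∑ k ∈ Finset.range (2 * n + 1), X ^ thetaExp r s ((k : ℤ) - n) - theta r s := by
  rw [X_pow_dvd_iff]
  intro d hd
  rw [map_sub, sub_eq_zero, map_sum, theta, genSeries, coeff_mk]
  simp only [coeff_X_pow]
  rw [Finset.sum_boole]
  congr 1
  rw [← Nat.card_eq_finsetCard]
  refine Nat.card_congr
    { toFun := fun k => ⟨((k : ℕ) : ℤ) - n, ((Finset.mem_filter.1 k.2).2).symm⟩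
      invFun := fun m => ⟨((m : ℤ) + n).toNat, ?_⟩
      left_inv := fun k => by ext; simp
      right_inv := fun m => ?_ }
  · have h1 := natAbs_le_thetaExp h m
    rw [m.2] at h1
    have h2 : (((m : ℤ) + n).toNat : ℤ) - n = m := by omega
    rw [Finset.mem_filter, Finset.mem_range, h2]
    exact ⟨by omega, m.2.symm⟩
  · have h1 := natAbs_le_thetaExp h m
    rw [m.2] at h1
    ext
    simp only
    omega

theorem choose_two_cast (k : ℕ) : 2 * (k.choose 2 : ℤ) = k * (k - 1) := by
  rw [Nat.choose_two_right]
  have h : 2 ∣ k * (k - 1) := (Nat.even_mul_pred_self k).two_dvd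
  have h2 : (2 * (k * (k - 1) / 2) : ℕ) = k * (k - 1) := Nat.mul_div_cancel' h
  zify at h2
  cases k with
  | zero => simp
  | succ k => push_cast at h2 ⊢; simpa using h2

/-- A finite form of the Jacobi triple product identity. -/
theorem prod_one_add_eq_sum_gaussBinom (r s n : ℕ) :
    ∏ i ∈ Finset.range n, ((1 + (X : ℤ⟦X⟧) ^ (r * (i + 1) + s * i)) *
        (1 + X ^ (r * i + s * (i + 1)))) =
      ∑ k ∈ Finset.range (2 * n + 1), gaussBinom (X ^ (r + s)) (2 * n) k *
        X ^ thetaExp r s ((k : ℤ) - n) := by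
  -- Homogenising with `y = X ^ ((r + s) * n)` centres the product without negative exponents. `D`
  -- collects the powers pulled out: each of the upper `n` factors gives up `(r + s) * n`, and the
  -- lower half, read backwards, gives up the binomial terms.
  have h1 := prod_add_mul_pow ((X : ℤ⟦X⟧) ^ (r + s)) (X ^ ((r + s) * n)) (X ^ r) (2 * n)
  set D := r * (n * n + (n + 1).choose 2) + s * (n * n + n.choose 2) with hD
  have h2 : ∏ i ∈ Finset.range (2 * n),
      ((X : ℤ⟦X⟧) ^ ((r + s) * n) + X ^ r * (X ^ (r + s)) ^ i) = X ^ D *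
      ∏ i ∈ Finset.range n, ((1 + (X : ℤ⟦X⟧) ^ (r * (i + 1) + s * i)) *
        (1 + X ^ (r * i + s * (i + 1)))) := by
    have e1 : ∀ i ∈ Finset.range n,
        ((X : ℤ⟦X⟧) ^ ((r + s) * n) + X ^ r * (X ^ (r + s)) ^ (n + i)) =
        X ^ ((r + s) * n) * (1 + (X : ℤ⟦X⟧) ^ (r * (i + 1) + s * i)) := fun i _ => by ring
    have e2 : ∀ i ∈ Finset.range n,
        ((X : ℤ⟦X⟧) ^ ((r + s) * n) + X ^ r * (X ^ (r + s)) ^ (n - 1 - i)) =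
        X ^ (r * (n - i) + s * (n - 1 - i)) * (1 + X ^ (r * i + s * (i + 1))) := fun i hi => by
      obtain ⟨j, rfl⟩ := Nat.exists_eq_add_of_lt (Finset.mem_range.1 hi)
      have a1 : i + j + 1 - 1 - i = j := by omega
      have a2 : i + j + 1 - i = j + 1 := by omega
      rw [a1, a2]; ring
    rw [two_mul, Finset.prod_range_add, ← Finset.prod_range_reflect, Finset.prod_congr rfl e1,
      Finset.prod_congr rfl e2, Finset.prod_mul_distrib, Finset.prod_mul_distrib,
      Finset.prod_mul_distrib, Finset.prod_pow_eq_pow_sum, Finset.prod_const, Finset.card_range]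
    have e3 : ∑ i ∈ Finset.range n, (r * (n - i) + s * (n - 1 - i)) =
        r * (n + 1).choose 2 + s * n.choose 2 := by
      have b1 : ∑ i ∈ Finset.range n, (n - 1 - i) = n.choose 2 := by
        rw [Finset.sum_range_reflect (fun i => i) n, Finset.sum_range_id, Nat.choose_two_right]
      have b2 : ∑ i ∈ Finset.range n, (n - i) = (n + 1).choose 2 := by
        rw [Nat.choose_succ_succ' n 1, Nat.choose_one_right, ← b1]
        have : ∑ i ∈ Finset.range n, (n - i) = ∑ i ∈ Finset.range n, (1 + (n - 1 - i)) :=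
          Finset.sum_congr rfl fun i hi => by have := Finset.mem_range.1 hi; omega
        rw [this, Finset.sum_add_distrib]
        simp
      rw [Finset.sum_add_distrib, ← Finset.mul_sum, ← Finset.mul_sum, b1, b2]
    rw [e3, hD]
    ring
  have h3 : ∀ k ∈ Finset.range (2 * n + 1), gaussBinom ((X : ℤ⟦X⟧) ^ (r + s)) (2 * n) k *
      (X ^ (r + s)) ^ k.choose 2 * (X ^ r) ^ k * (X ^ ((r + s) * n)) ^ (2 * n - k) =
      X ^ D * (gaussBinom (X ^ (r + s)) (2 * n) k * X ^ thetaExp r s ((k : ℤ) - n)) := by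
    intro k hk
    have hk : k ≤ 2 * n := Finset.mem_range_succ_iff.1 hk
    have e : (r + s) * k.choose 2 + r * k + (r + s) * n * (2 * n - k) =
        D + thetaExp r s ((k : ℤ) - n) := by
      have c1 := choose_two_cast k
      have c2 := choose_two_cast n
      have c3 := choose_two_cast (n + 1)
      have c4 := two_mul_thetaExp r s ((k : ℤ) - n)
      zify [hk]
      rw [hD]
      push_cast at c3 ⊢
      have : (2 : ℤ) ≠ 0 := by norm_num
      apply mul_left_cancel₀ this
      linear_combination ((r : ℤ) + s) * c1 - c4 - (r : ℤ) * c3 - (s : ℤ) * c2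
    calc _ = gaussBinom ((X : ℤ⟦X⟧) ^ (r + s)) (2 * n) k *
          X ^ ((r + s) * k.choose 2 + r * k + (r + s) * n * (2 * n - k)) := by ring
      _ = _ := by rw [e]; ring
  rw [h2, Finset.sum_congr rfl h3, ← Finset.mul_sum] at h1
  exact mul_left_cancel₀ (pow_ne_zero _ X_ne_zero) h1

/-- The Jacobi triple product identity. -/
theorem tendsto_theta {r s : ℕ} (h : 1 ≤ r + s) :
    Tendsto (fun n => eulerProd (r + s) * ∏ i ∈ Finset.range n,
        ((1 + (X : ℤ⟦X⟧) ^ (r * (i + 1) + s * i)) * (1 + X ^ (r * i + s * (i + 1)))))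
      atTop (𝓝 (theta r s)) := by
  refine tendsto_of_X_pow_dvd_sub fun n => ?_
  rw [prod_one_add_eq_sum_gaussBinom, ← sub_add_sub_cancel _
    (∑ k ∈ Finset.range (2 * n + 1), (X : ℤ⟦X⟧) ^ thetaExp r s ((k : ℤ) - n)) _]
  refine dvd_add ?_ (X_pow_dvd_sum_sub_theta h n)
  rw [Finset.mul_sum, ← Finset.sum_sub_distrib]
  refine Finset.dvd_sum fun k hk => ?_
  have hk : k ≤ 2 * n := Finset.mem_range_succ_iff.1 hk
  have h1 := X_pow_dvd_eulerProd_mul_gaussBinom_sub_one h (2 * n - k) k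
  rw [Nat.sub_add_cancel hk] at h1
  have h2 := mul_dvd_mul h1 (dvd_refl ((X : ℤ⟦X⟧) ^ thetaExp r s ((k : ℤ) - n)))
  rw [← pow_add] at h2
  have h3 := natAbs_le_thetaExp h ((k : ℤ) - n)
  convert (pow_dvd_pow _ _).trans h2 using 1
  · ring
  · omega

theorem finite_add_fibre {ι κ : Type*} {w : ι → ℕ} {v : κ → ℕ} (hw : ∀ n, Finite {i // w i = n})
    (hv : ∀ n, Finite {i // v i = n}) (n : ℕ) : Finite {p : ι × κ // w p.1 + v p.2 = n} := by
  have h1 : (⋃ a ∈ Finset.range (n + 1), {i | w i = a}).Finite :=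
    Set.Finite.biUnion (Finset.finite_toSet _) fun a _ => hw a
  have h2 : (⋃ a ∈ Finset.range (n + 1), {i | v i = a}).Finite :=
    Set.Finite.biUnion (Finset.finite_toSet _) fun a _ => hv a
  refine (h1.prod h2).subset fun p hp => ?_
  have hp : w p.1 + v p.2 = n := hp
  simp
  omega

/-! ### Theta identities from the Gaussian integers modulo 5. -/

/-- The residue class of a pair of integers that decides divisibility by a prime over `5` in the
Gaussian integers; `d` is an offset. -/
def residue (d : ℤ) (p : ℤ × ℤ) : ZMod 5 := ((p.1 + 2 * p.2 + d : ℤ) : ZMod 5)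

theorem residue_eq_iff (d c : ℤ) (p : ℤ × ℤ) :
    residue d p = (c : ZMod 5) ↔ (p.1 + 2 * p.2 + d) % 5 = c % 5 := by
  rw [residue, ZMod.intCast_eq_intCast_iff']
  rfl

theorem residue_eq_zero_iff (d : ℤ) (p : ℤ × ℤ) :
    residue d p = 0 ↔ (p.1 + 2 * p.2 + d) % 5 = 0 := by
  simpa using residue_eq_iff d 0 p

theorem residue_eq_one_iff (d : ℤ) (p : ℤ × ℤ) :
    residue d p = 1 ↔ (p.1 + 2 * p.2 + d) % 5 = 1 := by
  simpa using residue_eq_iff d 1 p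

/-- A sum over `ℤ × ℤ` that is invariant under a rotation of order four is split into the classes
of `x + 2 y + d` modulo `5`; the four nonzero classes contribute equally. -/
theorem genSeries_split_mod_five {w : ℤ × ℤ → ℕ} (hw : ∀ n, Finite {p // w p = n}) (d : ℤ)
    (ρ : ℤ × ℤ ≃ ℤ × ℤ) (hρ : ∀ p, w (ρ p) = w p)
    (hr : ∀ p, residue d (ρ p) = 2 * residue d p) :
    genSeries w = genSeries (fun p : {p // residue d p = 0} => w p) +
      4 * genSeries (fun p : {p // residue d p = 1} => w p) := by
  have key : ∀ c : ZMod 5, genSeries (fun p : {p // residue d p = c} => w p) =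
      genSeries (fun p : {p // residue d p = 2 * c} => w p) := fun c => by
    refine genSeries_congr (ρ.subtypeEquiv fun p => ?_) fun p => (hρ p).symm
    rw [hr]
    have : ∀ a b : ZMod 5, a = b ↔ 2 * a = 2 * b := by decide
    exact this _ _
  -- Since 2 generates the units modulo 5, the orbit 1, 2, 4, 3 runs through all nonzero classes.
  have k1 := key 1
  have k2 := key 2
  have k3 := key 4
  have e1 : (2 * 1 : ZMod 5) = 2 := rfl
  have e2 : (2 * 2 : ZMod 5) = 4 := rfl
  have e3 : (2 * 4 : ZMod 5) = 3 := rfl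
  rw [e1] at k1
  rw [e2] at k2
  rw [e3] at k3
  rw [genSeries_eq_sum hw (residue d)]
  have hs : ∀ F : ZMod 5 → ℤ⟦X⟧, ∑ c, F c = F 0 + F 1 + F 2 + F 3 + F 4 :=
    fun F => Fin.sum_univ_five F
  rw [hs]
  linear_combination (-3) * k1 - 2 * k2 - k3

theorem theta_mul_theta {r s r' s' : ℕ} (h : 1 ≤ r + s) (h' : 1 ≤ r' + s') :
    theta r s * theta r' s' = genSeries fun p : ℤ × ℤ => thetaExp r s p.1 + thetaExp r' s' p.2 :=
  genSeries_mul (finite_thetaExp h) (finite_thetaExp h')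

/-- The exponent is x² + y². The zero class is a sublattice similar to ℤ² with ratio √5, which
rescales q to q^5; completing the square on the class of 1 decouples the two variables. -/
theorem theta_one_one_sq :
    theta 1 1 ^ 2 = theta 5 5 ^ 2 + 4 * X * (theta 9 1 * theta 7 3) := by
  rw [sq, sq, theta_mul_theta (by norm_num) (by norm_num),
    theta_mul_theta (by norm_num) (by norm_num), theta_mul_theta (by norm_num) (by norm_num)]
  rw [genSeries_split_mod_five (finite_add_fibre (finite_thetaExp (by norm_num))
      (finite_thetaExp (by norm_num))) 0
    ⟨fun p => (-p.2, p.1), fun p => (p.2, -p.1), fun p => by simp, fun p => by simp⟩]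
  · congr 1
    · symm
      refine genSeries_congr
        ⟨fun p => ⟨(-2 * p.1 + p.2, p.1 + 2 * p.2), ?_⟩,
         fun p => (p.1.2 - 2 * ((p.1.1 + 2 * p.1.2) / 5), (p.1.1 + 2 * p.1.2) / 5), ?_, ?_⟩ ?_
      · rw [residue_eq_zero_iff]
        omega
      · intro p
        ext <;> simp <;> omega
      · intro p
        have := (residue_eq_zero_iff 0 p.1).1 p.2
        ext <;> simp <;> omega
      · intro p
        have h1 := two_mul_thetaExp 5 5 p.1
        have h2 := two_mul_thetaExp 5 5 p.2
        have h3 := two_mul_thetaExp 1 1 (-2 * p.1 + p.2)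
        have h4 := two_mul_thetaExp 1 1 (p.1 + 2 * p.2)
        simp only [Equiv.coe_fn_mk]
        zify
        apply mul_left_cancel₀ (two_ne_zero (α := ℤ))
        push_cast at *
        linear_combination h1 + h2 - h3 - h4
    · rw [mul_assoc]
      congr 1
      have := X_pow_mul_genSeries (fun p : ℤ × ℤ => thetaExp 9 1 p.1 + thetaExp 7 3 p.2) 1
      rw [pow_one] at this
      rw [this]
      symm
      refine genSeries_congr
        ⟨fun p => ⟨(2 * p.1 + p.2 + 1, 2 * p.2 - p.1), ?_⟩,
         fun p => (2 * ((p.1.1 + 2 * p.1.2) / 5) - p.1.2, (p.1.1 + 2 * p.1.2) / 5), ?_, ?_⟩ ?_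
      · rw [residue_eq_one_iff]
        omega
      · intro p
        ext <;> simp <;> omega
      · intro p
        have := (residue_eq_one_iff 0 p.1).1 p.2
        ext <;> simp <;> omega
      · intro p
        have h1 := two_mul_thetaExp 9 1 p.1
        have h2 := two_mul_thetaExp 7 3 p.2
        have h3 := two_mul_thetaExp 1 1 (2 * p.1 + p.2 + 1)
        have h4 := two_mul_thetaExp 1 1 (2 * p.2 - p.1)
        simp only [Equiv.coe_fn_mk]
        zify
        apply mul_left_cancel₀ (two_ne_zero (α := ℤ))
        push_cast at *
        linear_combination h1 + h2 - h3 - h4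
  · intro p
    have h1 := two_mul_thetaExp 1 1 p.2
    have h2 := two_mul_thetaExp 1 1 (-p.2)
    simp only [Equiv.coe_fn_mk]
    zify
    apply mul_left_cancel₀ (two_ne_zero (α := ℤ))
    linear_combination h2 - h1
  · intro p
    have e : (2 : ZMod 5) * residue 0 p = ((2 * (p.1 + 2 * p.2 + 0) : ℤ) : ZMod 5) := by
      rw [residue]; push_cast; ring
    rw [e, residue_eq_iff]
    simp only [Equiv.coe_fn_mk]
    omega

/-- The same argument around the centre (-1/2, -1/2) of triangular numbers. The offset 4 is chosen
so that x + 2y + 4 = 5/2 vanishes modulo 5 at that centre. -/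
theorem theta_one_zero_sq :
    theta 1 0 ^ 2 = X * theta 5 0 ^ 2 + 4 * (theta 4 1 * theta 3 2) := by
  rw [sq, sq, theta_mul_theta (by norm_num) (by norm_num),
    theta_mul_theta (by norm_num) (by norm_num), theta_mul_theta (by norm_num) (by norm_num)]
  rw [genSeries_split_mod_five (finite_add_fibre (finite_thetaExp (by norm_num))
      (finite_thetaExp (by norm_num))) 4
    ⟨fun p => (-p.2 - 1, p.1), fun p => (p.2, -p.1 - 1), fun p => by simp, fun p => by simp⟩]
  · congr 1
    · have := X_pow_mul_genSeries (fun p : ℤ × ℤ => thetaExp 5 0 p.1 + thetaExp 5 0 p.2) 1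
      rw [pow_one] at this
      rw [this]
      symm
      refine genSeries_congr
        ⟨fun p => ⟨(-2 * p.1 + p.2 - 1, p.1 + 2 * p.2 + 1), ?_⟩,
         fun p => (p.1.2 - 2 * ((p.1.1 + 2 * p.1.2 - 1) / 5) - 1, (p.1.1 + 2 * p.1.2 - 1) / 5),
         ?_, ?_⟩ ?_
      · rw [residue_eq_zero_iff]
        omega
      · intro p
        ext <;> simp <;> omega
      · intro p
        have := (residue_eq_zero_iff 4 p.1).1 p.2
        ext <;> simp <;> omega
      · intro p
        have h1 := two_mul_thetaExp 5 0 p.1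
        have h2 := two_mul_thetaExp 5 0 p.2
        have h3 := two_mul_thetaExp 1 0 (-2 * p.1 + p.2 - 1)
        have h4 := two_mul_thetaExp 1 0 (p.1 + 2 * p.2 + 1)
        simp only [Equiv.coe_fn_mk]
        zify
        apply mul_left_cancel₀ (two_ne_zero (α := ℤ))
        push_cast at *
        linear_combination h1 + h2 - h3 - h4
    · congr 1
      symm
      refine genSeries_congr
        ⟨fun p => ⟨(-2 * p.2 - p.1 - 1, -2 * p.1 + p.2 - 1), ?_⟩,
         fun p => (-((p.1.1 + 2 * p.1.2 + 3) / 5),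
          p.1.2 - 2 * ((p.1.1 + 2 * p.1.2 + 3) / 5) + 1), ?_, ?_⟩ ?_
      · rw [residue_eq_one_iff]
        omega
      · intro p
        ext <;> simp <;> omega
      · intro p
        have := (residue_eq_one_iff 4 p.1).1 p.2
        ext <;> simp <;> omega
      · intro p
        have h1 := two_mul_thetaExp 4 1 p.1
        have h2 := two_mul_thetaExp 3 2 p.2
        have h3 := two_mul_thetaExp 1 0 (-2 * p.2 - p.1 - 1)
        have h4 := two_mul_thetaExp 1 0 (-2 * p.1 + p.2 - 1)
        simp only [Equiv.coe_fn_mk]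
        zify
        apply mul_left_cancel₀ (two_ne_zero (α := ℤ))
        push_cast at *
        linear_combination h1 + h2 - h3 - h4
  · intro p
    have h1 := two_mul_thetaExp 1 0 p.2
    have h2 := two_mul_thetaExp 1 0 (-p.2 - 1)
    simp only [Equiv.coe_fn_mk]
    zify
    apply mul_left_cancel₀ (two_ne_zero (α := ℤ))
    push_cast at *
    linear_combination h2 - h1
  · intro p
    have e : (2 : ZMod 5) * residue 4 p = ((2 * (p.1 + 2 * p.2 + 4) : ℤ) : ZMod 5) := by
      rw [residue]; push_cast; ring
    rw [e, residue_eq_iff]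
    simp only [Equiv.coe_fn_mk]
    omega

/-! ### Theta functions as Euler quotients. -/

section products

variable {R : Type*} [CommRing R] (q : R) (n : ℕ)

theorem prod_one_add_pow_mul :
    (∏ i ∈ Finset.range n, (1 + q ^ (i + 1))) * qPochhammer q n = qPochhammer (q ^ 2) n := by
  rw [qPochhammer, qPochhammer, ← Finset.prod_mul_distrib]
  exact Finset.prod_congr rfl fun i _ => by ring

/-- A finite form of ∏ (1 + q^(2i+1)) = E(2)^2 / (E(1) E(4)); the lengths `n` and `2 * n` are
matched so that it is exact. -/
theorem prod_one_add_odd_pow_mul :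
    (∏ i ∈ Finset.range n, (1 + q ^ (2 * i + 1))) * (qPochhammer (q ^ 4) n *
      qPochhammer q (2 * n)) = qPochhammer (q ^ 2) (2 * n) * qPochhammer (q ^ 2) n := by
  induction n with
  | zero => simp [qPochhammer]
  | succ n ih =>
    rw [Finset.prod_range_succ, mul_add_one]
    simp only [qPochhammer_succ]
    linear_combination ((1 + q ^ (2 * n + 1)) * (1 - (q ^ 4) ^ (n + 1)) *
      ((1 - q ^ (2 * n + 1)) * (1 - q ^ (2 * n + 1 + 1)))) * ih

theorem qPochhammer_neg_two_mul :
    qPochhammer (-q) (2 * n) =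
      (∏ i ∈ Finset.range n, (1 + q ^ (2 * i + 1))) * qPochhammer (q ^ 2) n := by
  induction n with
  | zero => simp [qPochhammer]
  | succ n ih =>
    have h1 : (-q) ^ (2 * n + 1) = -q ^ (2 * n + 1) := Odd.neg_pow ⟨n, rfl⟩ q
    have h2 : (-q) ^ (2 * n + 1 + 1) = q ^ (2 * n + 1 + 1) := Even.neg_pow ⟨n + 1, by ring⟩ q
    rw [Finset.prod_range_succ, mul_add_one]
    simp only [qPochhammer_succ]
    rw [ih, h1, h2]
    ring

end products

theorem tendsto_two_mul : Tendsto (fun n : ℕ => 2 * n) atTop atTop :=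
  tendsto_id.const_mul_atTop' (by norm_num)

theorem tendsto_five_mul : Tendsto (fun n : ℕ => 5 * n) atTop atTop :=
  tendsto_id.const_mul_atTop' (by norm_num)

/-- `φ(q) = E(2)^5 / (E(1)^2 E(4)^2)`. -/
theorem theta_self_mul {c : ℕ} (hc : 1 ≤ c) :
    theta c c * (eulerProd (4 * c) * eulerProd c) ^ 2 = eulerProd (2 * c) ^ 5 := by
  have h1 := tendsto_theta (r := c) (s := c) (by omega)
  have h2 := tendsto_qPochhammer hc
  have h3 := tendsto_qPochhammer (k := 4 * c) (by omega)
  have h4 := tendsto_qPochhammer (k := 2 * c) (by omega)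
  have l := h1.mul ((h3.mul (h2.comp tendsto_two_mul)).pow 2)
  have r := (((h4.comp tendsto_two_mul).mul h4).pow 2).const_mul (eulerProd (2 * c))
  refine (tendsto_nhds_unique l ?_).trans (by ring :
    eulerProd (2 * c) * (eulerProd (2 * c) * eulerProd (2 * c)) ^ 2 = _)
  refine r.congr fun n => ?_
  have e := prod_one_add_odd_pow_mul ((X : ℤ⟦X⟧) ^ c) n
  simp only [← pow_mul, mul_comm c] at e
  have e2 : ∏ i ∈ Finset.range n, ((1 + (X : ℤ⟦X⟧) ^ (c * (i + 1) + c * i)) *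
      (1 + X ^ (c * i + c * (i + 1)))) =
      (∏ i ∈ Finset.range n, (1 + (X : ℤ⟦X⟧) ^ ((2 * i + 1) * c))) ^ 2 := by
    rw [← Finset.prod_pow]
    exact Finset.prod_congr rfl fun i _ => by ring
  simp only [Function.comp_apply]
  rw [e2, ← e, ← two_mul c]
  ring

/-- `2 ψ(q) = 2 E(2)^2 / E(1)`. -/
theorem theta_zero_mul {c : ℕ} (hc : 1 ≤ c) :
    theta c 0 * eulerProd c = 2 * eulerProd (2 * c) ^ 2 := by
  have h1 := tendsto_theta (r := c) (s := 0) (by omega)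
  have h2 := tendsto_qPochhammer hc
  have h4 := tendsto_qPochhammer (k := 2 * c) (by omega)
  -- With `n + 1` factors, the factor `1 + X ^ 0 = 2` splits off and leaves exactly `n` in the other
  -- product.
  have l := (h1.comp (tendsto_add_atTop_nat 1)).mul ((h2.comp (tendsto_add_atTop_nat 1)).mul h2)
  have r := (((h4.comp (tendsto_add_atTop_nat 1)).mul h4).const_mul (2 * eulerProd c))
  have key : theta c 0 * (eulerProd c * eulerProd c) =
      2 * eulerProd c * (eulerProd (2 * c) * eulerProd (2 * c)) := by
    refine tendsto_nhds_unique l (r.congr fun n => ?_)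
    have e1 := prod_one_add_pow_mul ((X : ℤ⟦X⟧) ^ c) n
    have e2 := prod_one_add_pow_mul ((X : ℤ⟦X⟧) ^ c) (n + 1)
    simp only [← pow_mul, mul_comm c] at e1 e2
    simp only [Function.comp_apply]
    rw [Finset.prod_mul_distrib, ← e1, ← e2]
    have e3 : ∏ i ∈ Finset.range (n + 1), (1 + (X : ℤ⟦X⟧) ^ (c * i + 0 * (i + 1))) =
        (∏ i ∈ Finset.range n, (1 + (X : ℤ⟦X⟧) ^ ((i + 1) * c))) * 2 := by
      rw [Finset.prod_range_succ']
      congr 1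
      · exact Finset.prod_congr rfl fun i _ => by ring
      · norm_num
    have e4 : ∏ i ∈ Finset.range (n + 1), (1 + (X : ℤ⟦X⟧) ^ (c * (i + 1) + 0 * i)) =
        ∏ i ∈ Finset.range (n + 1), (1 + (X : ℤ⟦X⟧) ^ ((i + 1) * c)) :=
      Finset.prod_congr rfl fun i _ => by ring
    rw [e3, e4, add_zero]
    generalize ∏ i ∈ Finset.range (n + 1), (1 + (X : ℤ⟦X⟧) ^ ((i + 1) * c)) = P
    ring
  apply mul_right_cancel₀ (eulerProd_ne_zero c)
  linear_combination key

/-- The exponents in the two triple products are ±1 and ±3 modulo 10, so together they are the odd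
numbers prime to 5: ∏ (1 + q^(2i+1)) divided by its version at q^5. -/
theorem theta_nine_one_mul_theta_seven_three :
    theta 9 1 * theta 7 3 * (eulerProd 1 * eulerProd 4) =
      eulerProd 2 ^ 2 * (eulerProd 5 * eulerProd 20) := by
  have h1 := tendsto_theta (r := 9) (s := 1) (by norm_num)
  have h2 := tendsto_theta (r := 7) (s := 3) (by norm_num)
  have p1 := tendsto_qPochhammer (k := 1) (by norm_num)
  have p2 := tendsto_qPochhammer (k := 2) (by norm_num)
  have p4 := tendsto_qPochhammer (k := 4) (by norm_num)
  have p5 := tendsto_qPochhammer (k := 5) (by norm_num)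
  have p10 := tendsto_qPochhammer (k := 10) (by norm_num)
  have p20 := tendsto_qPochhammer (k := 20) (by norm_num)
  have t5 := tendsto_five_mul
  have t10 := tendsto_two_mul.comp tendsto_five_mul
  have l := ((h1.mul h2).mul ((p1.comp t10).mul (p4.comp t5))).mul
    (((p10.comp tendsto_two_mul).mul p10))
  have r := (((p2.comp t10).mul (p2.comp t5)).mul ((p5.comp tendsto_two_mul).mul p20)).const_mul
    (eulerProd 10 * eulerProd 10)
  have key := tendsto_nhds_unique l (r.congr fun n => ?_)
  · apply mul_right_cancel₀ (mul_ne_zero (eulerProd_ne_zero 10) (eulerProd_ne_zero 10))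
    linear_combination key
  · have e1 := prod_one_add_odd_pow_mul (X : ℤ⟦X⟧) (5 * n)
    have e5 := prod_one_add_odd_pow_mul ((X : ℤ⟦X⟧) ^ 5) n
    simp only [← pow_mul, Nat.reduceMul] at e5
    have e : (∏ i ∈ Finset.range (5 * n), (1 + (X : ℤ⟦X⟧) ^ (2 * i + 1))) =
        (∏ i ∈ Finset.range n, ((1 + (X : ℤ⟦X⟧) ^ (9 * (i + 1) + 1 * i)) *
          (1 + X ^ (9 * i + 1 * (i + 1))))) *
        (∏ i ∈ Finset.range n, ((1 + (X : ℤ⟦X⟧) ^ (7 * (i + 1) + 3 * i)) *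
          (1 + X ^ (7 * i + 3 * (i + 1))))) *
        (∏ i ∈ Finset.range n, (1 + (X : ℤ⟦X⟧) ^ (5 * (2 * i + 1)))) := by
      clear * -
      induction n with
      | zero => simp
      | succ n ih =>
        rw [mul_add_one]
        simp only [Finset.prod_range_succ, ih]
        ring
    simp only [Function.comp_apply, pow_one]
    rw [← e1, ← e5, e]
    norm_num only
    ring

/-- The exponents ±1 and ±2 modulo 5 exhaust the numbers prime to 5, so the triple products combine
to ∏ (1 + q^i) divided by its version at q^5. -/
theorem theta_four_one_mul_theta_three_two :
    theta 4 1 * theta 3 2 * (eulerProd 1 * eulerProd 10) = eulerProd 5 ^ 3 * eulerProd 2 := by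
  have h1 := tendsto_theta (r := 4) (s := 1) (by norm_num)
  have h2 := tendsto_theta (r := 3) (s := 2) (by norm_num)
  have p1 := tendsto_qPochhammer (k := 1) (by norm_num)
  have p2 := tendsto_qPochhammer (k := 2) (by norm_num)
  have p5 := tendsto_qPochhammer (k := 5) (by norm_num)
  have p10 := tendsto_qPochhammer (k := 10) (by norm_num)
  have t5 := tendsto_five_mul
  have l := (h1.mul h2).mul ((p1.comp t5).mul p10)
  have r := ((p2.comp t5).mul p5).const_mul (eulerProd 5 * eulerProd 5)
  have key := tendsto_nhds_unique l (r.congr fun n => ?_)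
  · linear_combination key
  · have e1 := prod_one_add_pow_mul (X : ℤ⟦X⟧) (5 * n)
    have e5 := prod_one_add_pow_mul ((X : ℤ⟦X⟧) ^ 5) n
    simp only [← pow_mul, Nat.reduceMul] at e5
    have e : (∏ i ∈ Finset.range (5 * n), (1 + (X : ℤ⟦X⟧) ^ (i + 1))) =
        (∏ i ∈ Finset.range n, ((1 + (X : ℤ⟦X⟧) ^ (4 * (i + 1) + 1 * i)) *
          (1 + X ^ (4 * i + 1 * (i + 1))))) *
        (∏ i ∈ Finset.range n, ((1 + (X : ℤ⟦X⟧) ^ (3 * (i + 1) + 2 * i)) *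
          (1 + X ^ (3 * i + 2 * (i + 1))))) *
        (∏ i ∈ Finset.range n, (1 + (X : ℤ⟦X⟧) ^ (5 * (i + 1)))) := by
      clear * -
      induction n with
      | zero => simp
      | succ n ih =>
        rw [mul_add_one]
        simp only [Finset.prod_range_succ, ih]
        ring
    simp only [Function.comp_apply, pow_one]
    rw [← e1, ← e5, e]
    norm_num only
    ring

/-! ### The substitutions q ↦ q^p and q ↦ -q. -/

theorem expand_eulerProd {p k : ℕ} (hp : p ≠ 0) (hk : 1 ≤ k) :
    expand p hp (eulerProd k) = eulerProd (p * k) := by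
  refine eq_of_X_pow_dvd_sub fun n => ?_
  have h1 := map_dvd (expand p hp) (X_pow_dvd_eulerProd_sub hk n)
  have h2 := X_pow_dvd_eulerProd_sub (k := p * k) (Nat.mul_pos (Nat.pos_of_ne_zero hp) hk) n
  have h3 : expand p hp (qPochhammer ((X : ℤ⟦X⟧) ^ k) n) = qPochhammer (X ^ (p * k)) n := by
    have := map_qPochhammer (expand p hp : ℤ⟦X⟧ →ₐ[ℤ] ℤ⟦X⟧).toRingHom ((X : ℤ⟦X⟧) ^ k) n
    simp only [AlgHom.toRingHom_eq_coe, RingHom.coe_coe, map_pow, expand_X] at this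
    rw [this, pow_mul]
  rw [map_sub, map_pow, expand_X, h3, ← pow_mul] at h1
  have h4 := dvd_sub ((pow_dvd_pow X (by nlinarith [Nat.pos_of_ne_zero hp])).trans h1)
    ((pow_dvd_pow (X : ℤ⟦X⟧) (Nat.le_succ n)).trans h2)
  simpa using h4

theorem tendsto_rescale {s : ℕ → ℤ⟦X⟧} {f : ℤ⟦X⟧} (a : ℤ) (h : Tendsto s atTop (𝓝 f)) :
    Tendsto (fun n => rescale a (s n)) atTop (𝓝 (rescale a f)) := by
  rw [PowerSeries.WithPiTopology.tendsto_iff_coeff_tendsto] at h ⊢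
  intro d
  simp only [coeff_rescale]
  exact (h d).const_mul _

theorem rescale_eulerProd_of_even {k : ℕ} (hk : Even k) :
    rescale (-1 : ℤ) (eulerProd k) = eulerProd k := by
  ext d
  have h : rescale (-1 : ℤ) (qPochhammer ((X : ℤ⟦X⟧) ^ k) d) = qPochhammer (X ^ k) d := by
    rw [map_qPochhammer, map_pow, rescale_neg_one_X, hk.neg_pow]
  have := congrArg (coeff d) h
  rw [coeff_rescale] at this ⊢
  rwa [eulerProd, coeff_mk]

/-- For odd k, only the factors of odd index change sign, and ∏ (1 + q^(k(2i+1))) is already known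
as an Euler quotient. -/
theorem rescale_eulerProd_of_odd {k : ℕ} (hk : Odd k) :
    rescale (-1 : ℤ) (eulerProd k) * (eulerProd k * eulerProd (4 * k)) = eulerProd (2 * k) ^ 3 := by
  have hk' := hk.pos
  have h1 := tendsto_qPochhammer (k := k) (by omega)
  have h2 := tendsto_qPochhammer (k := 2 * k) (by omega)
  have h4 := tendsto_qPochhammer (k := 4 * k) (by omega)
  have l := ((tendsto_rescale (-1) h1).comp tendsto_two_mul).mul ((h1.comp tendsto_two_mul).mul h4)
  have r := ((h2.comp tendsto_two_mul).mul h2).mul h2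
  have key := tendsto_nhds_unique l (r.congr fun n => ?_)
  · linear_combination key
  · simp only [Function.comp_apply]
    have e := prod_one_add_odd_pow_mul ((X : ℤ⟦X⟧) ^ k) n
    have e2 := qPochhammer_neg_two_mul ((X : ℤ⟦X⟧) ^ k) n
    rw [map_qPochhammer, map_pow, rescale_neg_one_X, hk.neg_pow, e2]
    simp only [← pow_mul, mul_comm k] at e ⊢
    rw [← e]
    ring

/-! ### The modular equation and the even parts in a field. -/

section field

variable {K : Type*} [Field K]

/-- The modular equation of degree two between `g = g(q)`, `h = g(-q)` and `c = g(q²)`. -/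
theorem add_eq_of_modular [CharZero K] {g h c : K} (hp : g * h = -c)
    (hm : (1 - 4 * g) * (1 - 4 * h) = (1 - 4 * c) ^ 2) : g + h = -2 * c - 4 * c ^ 2 := by
  have h4 : (4 : K) ≠ 0 := by norm_num
  apply mul_left_cancel₀ h4
  linear_combination 16 * hp - hm

/-- The left side is symmetric in g and h, hence determined by their sum and product. The right side
is arranged so that, after scaling, its three terms become F, S and V F at q^2. -/
theorem inv_sq_add_inv_sq {g h c : K} (hg : g ≠ 0) (hh : h ≠ 0) (hc : c ≠ 0) (hp : g * h = -c)
    (hs : g + h = -2 * c - 4 * c ^ 2) :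
    1 / g ^ 2 + 1 / h ^ 2 = 2 * (9 + (1 + c) * (1 - 4 * c) ^ 2 / c - 8 * c ^ 2) := by
  have : 1 / g ^ 2 + 1 / h ^ 2 = ((g + h) ^ 2 - 2 * (g * h)) / (g * h) ^ 2 := by
    field_simp; ring
  rw [this, hs, hp]
  field_simp
  ring

theorem cusp_add_cusp {g h c : K} (hg : g ≠ 0) (hh : h ≠ 0) (hc : c ≠ 0) (hp : g * h = -c)
    (hs : g + h = -2 * c - 4 * c ^ 2) :
    (1 + g) * (1 - 4 * g) ^ 2 / g ^ 3 + (1 + h) * (1 - 4 * h) ^ 2 / h ^ 3 =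
      2 * (-4 * ((1 + c) * (1 - 4 * c) ^ 2 / c) - 8 * ((1 + c) ^ 2 * (1 - 4 * c))) := by
  have : (1 + g) * (1 - 4 * g) ^ 2 / g ^ 3 + (1 + h) * (1 - 4 * h) ^ 2 / h ^ 3 =
      ((g + h) ^ 3 - 3 * (g * h) * (g + h)) / (g * h) ^ 3 -
      7 * (((g + h) ^ 2 - 2 * (g * h)) / (g * h) ^ 2) + 8 * ((g + h) / (g * h)) + 32 := by
    field_simp; ring
  rw [this, hs, hp]
  field_simp
  ring

/-- The even parts of two eta quotients of level five, from the three-term relations between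
theta functions at `q`, `-q` and `q²`. The variable `aₖ` stands for `eulerProd k`. -/
theorem even_parts [CharZero K] {x a₁ a₂ a₄ a₅ a₁₀ a₂₀ : K} (hx : x ≠ 0) (h₁ : a₁ ≠ 0)
    (h₂ : a₂ ≠ 0) (h₄ : a₄ ≠ 0) (h₅ : a₅ ≠ 0) (h₁₀ : a₁₀ ≠ 0) (h₂₀ : a₂₀ ≠ 0)
    (hA : (a₁ ^ 2 / a₂) ^ 2 = (a₅ ^ 2 / a₁₀) ^ 2 - 4 * x * (a₁₀ ^ 3 * a₁ / (a₂ * a₅)))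
    (hA₂ : (a₂ ^ 2 / a₄) ^ 2 = (a₁₀ ^ 2 / a₂₀) ^ 2 - 4 * x ^ 2 * (a₂₀ ^ 3 * a₂ / (a₄ * a₁₀)))
    (hA' : (a₂ ^ 5 / (a₁ * a₄) ^ 2) ^ 2 = (a₁₀ ^ 5 / (a₅ * a₂₀) ^ 2) ^ 2 +
      4 * x * (a₂ ^ 2 * (a₅ * a₂₀) / (a₁ * a₄)))
    (hB : (a₂ ^ 2 / a₁) ^ 2 = x * (a₁₀ ^ 2 / a₅) ^ 2 + a₅ ^ 3 * a₂ / (a₁ * a₁₀))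
    (hB₂ : (a₄ ^ 2 / a₂) ^ 2 = x ^ 2 * (a₂₀ ^ 2 / a₁₀) ^ 2 + a₁₀ ^ 3 * a₄ / (a₂ * a₂₀))
    (hB' : (a₁ * a₄ / a₂) ^ 2 = -x * (a₅ * a₂₀ / a₁₀) ^ 2 +
      a₁₀ ^ 8 * (a₁ * a₄) / ((a₅ * a₂₀) ^ 3 * a₂ ^ 2)) :
    (x ^ 2 * a₅ ^ 10 / a₁ ^ 2 + x ^ 2 * (a₁₀ ^ 3 / (a₅ * a₂₀)) ^ 10 / (a₂ ^ 3 / (a₁ * a₄)) ^ 2 =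
      2 * (9 * (x ^ 4 * a₁₀ ^ 10 / a₂ ^ 2) + x ^ 2 * a₂ ^ 4 * a₁₀ ^ 4 -
        8 * (x ^ 8 * a₂₀ ^ 10 / a₄ ^ 2))) ∧
    (x * a₁ ^ 4 * a₅ ^ 4 - x * (a₂ ^ 3 / (a₁ * a₄)) ^ 4 * (a₁₀ ^ 3 / (a₅ * a₂₀)) ^ 4 =
      2 * (-4 * (x ^ 2 * a₂ ^ 4 * a₁₀ ^ 4) - 8 * (x ^ 4 * a₄ ^ 4 * a₂₀ ^ 4))) := by
  -- `h` and `c` are `g` at -q and q^2, and `v` is q E(5)^5 / E(1) at q^2. Then `v / g` is q E(5)^5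
  -- / E(1) itself, and the cusp form is `v ^ 2 * (1 + g) * (1 - 4 * g) ^ 2 / g ^ 3`.
  obtain ⟨g, hg⟩ : ∃ g, g = x * a₁₀ ^ 5 * a₁ / (a₂ * a₅ ^ 5) := ⟨_, rfl⟩
  obtain ⟨c, hc⟩ : ∃ c, c = x ^ 2 * a₂₀ ^ 5 * a₂ / (a₄ * a₁₀ ^ 5) := ⟨_, rfl⟩
  obtain ⟨h, hh⟩ : ∃ h, h = -(x * a₂₀ ^ 5 * a₂ ^ 2 * a₅ ^ 5 / (a₄ * a₁₀ ^ 10 * a₁)) := ⟨_, rfl⟩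
  obtain ⟨v, hv⟩ : ∃ v, v = x ^ 2 * a₁₀ ^ 5 / a₂ := ⟨_, rfl⟩
  have g0 : g ≠ 0 := by rw [hg]; positivity
  have c0 : c ≠ 0 := by rw [hc]; positivity
  have h0 : h ≠ 0 := by rw [hh]; exact neg_ne_zero.2 (by positivity)
  have hp : g * h = -c := by rw [hg, hh, hc]; field_simp
  -- Each theta relation, divided by one of its terms, yields one factorisation: the `hA` family
  -- gives the `1 - 4 *` quotients, the `hB` family the `1 +` quotients.
  have e₁ : 1 - 4 * g = a₁ ^ 4 * a₁₀ ^ 2 / (a₂ ^ 2 * a₅ ^ 4) := by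
    rw [hg]; field_simp at hA ⊢; linear_combination -hA
  have e₂ : 1 - 4 * h = a₂ ^ 10 * a₅ ^ 4 * a₂₀ ^ 4 / (a₁ ^ 4 * a₄ ^ 4 * a₁₀ ^ 10) := by
    rw [hh]; field_simp at hA' ⊢; linear_combination -hA'
  have e₃ : 1 - 4 * c = a₂ ^ 4 * a₂₀ ^ 2 / (a₄ ^ 2 * a₁₀ ^ 4) := by
    rw [hc]; field_simp at hA₂ ⊢; linear_combination -hA₂
  have e₄ : 1 + g = a₂ ^ 3 * a₁₀ / (a₁ * a₅ ^ 3) := by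
    rw [hg]; field_simp at hB ⊢; linear_combination -hB
  have e₅ : 1 + c = a₄ ^ 3 * a₂₀ / (a₂ * a₁₀ ^ 3) := by
    rw [hc]; field_simp at hB₂ ⊢; linear_combination -hB₂
  have e₆ : 1 + h = a₁ * a₄ * a₅ ^ 3 * a₂₀ ^ 3 / a₁₀ ^ 8 := by
    rw [hh]; field_simp at hB' ⊢; linear_combination -hB'
  have hs := add_eq_of_modular hp (by rw [e₁, e₂, e₃]; field_simp)
  have r1 := inv_sq_add_inv_sq g0 h0 c0 hp hs
  have r2 := cusp_add_cusp g0 h0 c0 hp hs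
  rw [e₁, e₂, e₃, e₄, e₅, e₆] at r2
  rw [e₃, e₅] at r1
  constructor
  · have := congrArg (v ^ 2 * ·) r1
    simp only [mul_add, mul_sub] at this ⊢
    convert this using 2
    · rw [hv, hg]; field_simp
    · rw [hv, hh]; field_simp
    · rw [hv, hc]; field_simp
    · rw [hv, hc]; field_simp
  · have := congrArg (v ^ 2 * ·) r2
    simp only [mul_add, mul_sub] at this ⊢
    rw [sub_eq_add_neg]
    convert this using 2
    · rw [hv, hg]; field_simp
    · rw [hv, hh]; field_simp
    · rw [hv, hc]; field_simp
    · rw [hv]; field_simp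

end field

/-! ### The theta relations in a field, at q, -q and q^2. -/

section relations

variable {K : Type*} [Field K]

theorem map_eulerProd_ne_zero (φ : ℤ⟦X⟧ →+* K) (k : ℕ) : φ (eulerProd k) ≠ 0 :=
  ((isUnit_eulerProd k).map φ).ne_zero

/-- Stated for an arbitrary homomorphism into a field, so that the versions at -q and q^2 come from
composing `φ` with the substitution. -/
theorem map_theta_one_one_relation (φ : ℤ⟦X⟧ →+* K) :
    (φ (eulerProd 2) ^ 5 / (φ (eulerProd 1) * φ (eulerProd 4)) ^ 2) ^ 2 =
      (φ (eulerProd 10) ^ 5 / (φ (eulerProd 5) * φ (eulerProd 20)) ^ 2) ^ 2 +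
      4 * φ X * (φ (eulerProd 2) ^ 2 * (φ (eulerProd 5) * φ (eulerProd 20)) /
        (φ (eulerProd 1) * φ (eulerProd 4))) := by
  have n := map_eulerProd_ne_zero φ
  have h1 := congrArg φ (theta_self_mul (c := 1) le_rfl)
  have h5 := congrArg φ (theta_self_mul (c := 5) (by norm_num))
  have h := congrArg φ theta_nine_one_mul_theta_seven_three
  have key := congrArg φ theta_one_one_sq
  simp only [map_mul, map_pow, map_add, map_ofNat, Nat.reduceMul] at h1 h5 h key
  have e1 : φ (theta 1 1) = φ (eulerProd 2) ^ 5 / (φ (eulerProd 1) * φ (eulerProd 4)) ^ 2 := by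
    rw [eq_div_iff (pow_ne_zero 2 (mul_ne_zero (n _) (n _))), ← h1, mul_comm (φ (eulerProd 1))]
  have e5 : φ (theta 5 5) = φ (eulerProd 10) ^ 5 / (φ (eulerProd 5) * φ (eulerProd 20)) ^ 2 := by
    rw [eq_div_iff (pow_ne_zero 2 (mul_ne_zero (n _) (n _))), ← h5, mul_comm (φ (eulerProd 5))]
  have e : φ (theta 9 1) * φ (theta 7 3) = φ (eulerProd 2) ^ 2 *
      (φ (eulerProd 5) * φ (eulerProd 20)) / (φ (eulerProd 1) * φ (eulerProd 4)) := by
    rw [eq_div_iff (mul_ne_zero (n _) (n _)), ← h]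
  rw [← e1, ← e5, ← e, key]

theorem map_theta_one_zero_relation [CharZero K] (φ : ℤ⟦X⟧ →+* K) :
    (φ (eulerProd 2) ^ 2 / φ (eulerProd 1)) ^ 2 =
      φ X * (φ (eulerProd 10) ^ 2 / φ (eulerProd 5)) ^ 2 +
      φ (eulerProd 5) ^ 3 * φ (eulerProd 2) / (φ (eulerProd 1) * φ (eulerProd 10)) := by
  have n := map_eulerProd_ne_zero φ
  have h1 := congrArg φ (theta_zero_mul (c := 1) le_rfl)
  have h5 := congrArg φ (theta_zero_mul (c := 5) (by norm_num))
  have h := congrArg φ theta_four_one_mul_theta_three_two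
  have key := congrArg φ theta_one_zero_sq
  simp only [map_mul, map_pow, map_add, map_ofNat, Nat.reduceMul] at h1 h5 h key
  have e1 : φ (theta 1 0) = 2 * (φ (eulerProd 2) ^ 2 / φ (eulerProd 1)) := by
    rw [← mul_div_assoc, eq_div_iff (n _), ← h1]
  have e5 : φ (theta 5 0) = 2 * (φ (eulerProd 10) ^ 2 / φ (eulerProd 5)) := by
    rw [← mul_div_assoc, eq_div_iff (n _), ← h5]
  have e : φ (theta 4 1) * φ (theta 3 2) = φ (eulerProd 5) ^ 3 * φ (eulerProd 2) /
      (φ (eulerProd 1) * φ (eulerProd 10)) := by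
    rw [eq_div_iff (mul_ne_zero (n _) (n _)), ← h]
  rw [e, e1, e5] at key
  apply mul_left_cancel₀ (by norm_num : (4 : K) ≠ 0)
  linear_combination key

theorem map_rescale_eulerProd_of_odd (φ : ℤ⟦X⟧ →+* K) {k : ℕ} (hk : Odd k) :
    φ (rescale (-1 : ℤ) (eulerProd k)) =
      φ (eulerProd (2 * k)) ^ 3 / (φ (eulerProd k) * φ (eulerProd (4 * k))) := by
  rw [eq_div_iff (mul_ne_zero (map_eulerProd_ne_zero φ _) (map_eulerProd_ne_zero φ _)),
    ← map_mul, ← map_mul, ← map_pow]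
  exact congrArg φ (rescale_eulerProd_of_odd hk)

theorem map_theta_one_one_relation_neg (φ : ℤ⟦X⟧ →+* K) :
    (φ (eulerProd 1) ^ 2 / φ (eulerProd 2)) ^ 2 = (φ (eulerProd 5) ^ 2 / φ (eulerProd 10)) ^ 2 -
      4 * φ X * (φ (eulerProd 10) ^ 3 * φ (eulerProd 1) /
        (φ (eulerProd 2) * φ (eulerProd 5))) := by
  have n := map_eulerProd_ne_zero φ
  have h := map_theta_one_one_relation (φ.comp (rescale (-1 : ℤ)))
  simp only [RingHom.comp_apply, map_rescale_eulerProd_of_odd φ odd_one,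
    map_rescale_eulerProd_of_odd φ (show Odd 5 by decide),
    rescale_eulerProd_of_even (show Even 2 by decide),
    rescale_eulerProd_of_even (show Even 4 by decide),
    rescale_eulerProd_of_even (show Even 10 by decide),
    rescale_eulerProd_of_even (show Even 20 by decide), rescale_neg_one_X, map_neg,
    Nat.reduceMul] at h
  have n1 := n 1
  have n2 := n 2
  have n4 := n 4
  have n5 := n 5
  have n10 := n 10
  have n20 := n 20
  generalize φ (eulerProd 1) = a₁ at *
  generalize φ (eulerProd 2) = a₂ at *
  generalize φ (eulerProd 4) = a₄ at *
  generalize φ (eulerProd 5) = a₅ at *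
  generalize φ (eulerProd 10) = a₁₀ at *
  generalize φ (eulerProd 20) = a₂₀ at *
  generalize φ X = x at *
  have e1 : a₁ ^ 2 / a₂ = a₂ ^ 5 / (a₂ ^ 3 / (a₁ * a₄) * a₄) ^ 2 := by field_simp
  have e5 : a₅ ^ 2 / a₁₀ = a₁₀ ^ 5 / (a₁₀ ^ 3 / (a₅ * a₂₀) * a₂₀) ^ 2 := by field_simp
  rw [e1, e5, h, sub_eq_add_neg]
  congr 1
  field_simp

theorem map_theta_one_zero_relation_neg [CharZero K] (φ : ℤ⟦X⟧ →+* K) :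
    (φ (eulerProd 1) * φ (eulerProd 4) / φ (eulerProd 2)) ^ 2 =
      -φ X * (φ (eulerProd 5) * φ (eulerProd 20) / φ (eulerProd 10)) ^ 2 +
      φ (eulerProd 10) ^ 8 * (φ (eulerProd 1) * φ (eulerProd 4)) /
        ((φ (eulerProd 5) * φ (eulerProd 20)) ^ 3 * φ (eulerProd 2) ^ 2) := by
  have n := map_eulerProd_ne_zero φ
  have h := map_theta_one_zero_relation (φ.comp (rescale (-1 : ℤ)))
  simp only [RingHom.comp_apply, map_rescale_eulerProd_of_odd φ odd_one,
    map_rescale_eulerProd_of_odd φ (show Odd 5 by decide),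
    rescale_eulerProd_of_even (show Even 2 by decide),
    rescale_eulerProd_of_even (show Even 10 by decide), rescale_neg_one_X, map_neg,
    Nat.reduceMul] at h
  have n1 := n 1
  have n2 := n 2
  have n4 := n 4
  have n5 := n 5
  have n10 := n 10
  have n20 := n 20
  generalize φ (eulerProd 1) = a₁ at *
  generalize φ (eulerProd 2) = a₂ at *
  generalize φ (eulerProd 4) = a₄ at *
  generalize φ (eulerProd 5) = a₅ at *
  generalize φ (eulerProd 10) = a₁₀ at *
  generalize φ (eulerProd 20) = a₂₀ at *
  generalize φ X = x at *
  have e1 : a₁ * a₄ / a₂ = a₂ ^ 2 / (a₂ ^ 3 / (a₁ * a₄)) := by field_simp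
  have e5 : a₅ * a₂₀ / a₁₀ = a₁₀ ^ 2 / (a₁₀ ^ 3 / (a₅ * a₂₀)) := by field_simp
  rw [e1, e5, h]
  congr 1
  field_simp

theorem map_coreSeries (φ : ℤ⟦X⟧ →+* K) {C : ℤ⟦X⟧} (hC : eulerProd 1 * C = eulerProd 5 ^ 5) :
    φ C = φ (eulerProd 5) ^ 5 / φ (eulerProd 1) := by
  rw [eq_div_iff (map_eulerProd_ne_zero φ _), ← map_mul, mul_comm, hC, map_pow]

/-- The cusp form `q E(1)^4 E(5)^4` of weight four and level five. -/
noncomputable def cuspSeries : ℤ⟦X⟧ := X * eulerProd 1 ^ 4 * eulerProd 5 ^ 4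

theorem map_even_parts [CharZero K] (ι : ℤ⟦X⟧ →+* K) (hX : ι X ≠ 0) {V : ℤ⟦X⟧ →+* ℤ⟦X⟧}
    (hVX : V X = X ^ 2) (hVE : ∀ k, 1 ≤ k → V (eulerProd k) = eulerProd (2 * k)) {C : ℤ⟦X⟧}
    (hC : eulerProd 1 * C = eulerProd 5 ^ 5) :
    ι ((X * C) ^ 2 + rescale (-1 : ℤ) ((X * C) ^ 2)) =
      ι (V (2 * (9 * (X * C) ^ 2 + cuspSeries - 8 * V ((X * C) ^ 2)))) ∧
    ι (cuspSeries + rescale (-1 : ℤ) cuspSeries) =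
      ι (V (2 * (-4 * cuspSeries - 8 * V cuspSeries))) := by
  have n := map_eulerProd_ne_zero ι
  have hA' := map_theta_one_one_relation ι
  have hB := map_theta_one_zero_relation ι
  have hA := map_theta_one_one_relation_neg ι
  have hB' := map_theta_one_zero_relation_neg ι
  have hB₂ := map_theta_one_zero_relation (ι.comp V)
  have hA₂ := map_theta_one_one_relation_neg (ι.comp V)
  have c0 := map_coreSeries ι hC
  have c1 := map_coreSeries (ι.comp (rescale (-1 : ℤ))) hC
  have c2 := map_coreSeries (ι.comp V) hC
  have c3 := map_coreSeries ((ι.comp V).comp V) hC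
  simp only [RingHom.comp_apply, hVE 1 le_rfl, hVE 2 one_le_two, hVE 5 (by norm_num),
    hVE 10 (by norm_num), hVX, Nat.reduceMul, map_pow, map_rescale_eulerProd_of_odd ι odd_one,
    map_rescale_eulerProd_of_odd ι (show Odd 5 by decide)] at hB₂ hA₂ c0 c1 c2 c3
  have key := even_parts hX (n 1) (n 2) (n 4) (n 5) (n 10) (n 20) hA hA₂ hA' hB hB₂ hB'
  simp only [cuspSeries, map_add, map_sub, map_mul, map_pow, map_neg, map_ofNat, hVX,
    rescale_neg_one_X, hVE 1 le_rfl, hVE 5 (by norm_num), hVE 2 one_le_two, hVE 10 (by norm_num),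
    Nat.reduceMul, c0, c1, c2, c3, map_rescale_eulerProd_of_odd ι odd_one,
    map_rescale_eulerProd_of_odd ι (show Odd 5 by decide)]
  constructor
  · linear_combination key.1
  · linear_combination key.2

end relations

/-- The even parts of `q² C²` and of the cusp form, where `C = E(5)^5 / E(1)`. -/
theorem even_parts_coreSeries {C : ℤ⟦X⟧} (hC : eulerProd 1 * C = eulerProd 5 ^ 5) :
    (X * C) ^ 2 + rescale (-1 : ℤ) ((X * C) ^ 2) =
      expand 2 two_ne_zero (2 * (9 * (X * C) ^ 2 + cuspSeries -
        8 * expand 2 two_ne_zero ((X * C) ^ 2))) ∧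
    cuspSeries + rescale (-1 : ℤ) cuspSeries =
      expand 2 two_ne_zero (2 * (-4 * cuspSeries - 8 * expand 2 two_ne_zero cuspSeries)) := by
  -- Divisions take place in the fraction field; injectivity brings the identities back to power
  -- series.
  have hinj := IsFractionRing.injective ℤ⟦X⟧ (FractionRing ℤ⟦X⟧)
  have : CharZero (FractionRing ℤ⟦X⟧) :=
    charZero_of_injective_ringHom
      (f := (algebraMap ℤ⟦X⟧ (FractionRing ℤ⟦X⟧)).comp (PowerSeries.C (R := ℤ)))
      (hinj.comp PowerSeries.C_injective)
  have key := map_even_parts (algebraMap ℤ⟦X⟧ (FractionRing ℤ⟦X⟧))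
    ((map_ne_zero_iff _ hinj).2 X_ne_zero)
    (V := (expand 2 two_ne_zero : ℤ⟦X⟧ →ₐ[ℤ] ℤ⟦X⟧).toRingHom)
    (expand_X 2 two_ne_zero) (fun k hk => expand_eulerProd two_ne_zero hk) hC
  exact ⟨hinj key.1, hinj key.2⟩

/-! ### Partitions as bead sets. -/

section beads

variable (L : ℕ) (μ : YoungDiagram)

/-- The position of bead `i` on the abacus with `L` beads of a partition. -/
def beadPos (i : ℕ) : ℕ := μ.rowLen i + (L - 1 - i)

/-- The first-column hook numbers of a partition, padded to a set of `L` beads. -/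
def beads : Finset ℕ := (Finset.range L).image (beadPos L μ)

variable {L μ}

theorem beadPos_lt {i k : ℕ} (h : i < k) (hk : k < L) : beadPos L μ k < beadPos L μ i := by
  have := μ.rowLen_anti i k h.le
  simp only [beadPos]
  omega

theorem beadPos_injOn : Set.InjOn (beadPos L μ) (Finset.range L) := by
  intro i hi k hk h
  simp only [Finset.coe_range, Set.mem_Iio] at hi hk
  rcases lt_trichotomy i k with h' | h' | h'
  · have := beadPos_lt (μ := μ) h' hk; omega
  · exact h'
  · have := beadPos_lt (μ := μ) h' hi; omega

theorem mem_beads {x : ℕ} : x ∈ beads L μ ↔ ∃ i < L, beadPos L μ i = x := by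
  simp [beads]

theorem card_beads : (beads L μ).card = L := by
  rw [beads, Finset.card_image_of_injOn beadPos_injOn, Finset.card_range]

theorem card_eq_sum_rowLen (h : μ.colLen 0 ≤ L) : μ.card = ∑ i ∈ Finset.range L, μ.rowLen i := by
  have hmaps : ∀ c ∈ μ.cells, c.1 ∈ Finset.range L := fun c hc => by
    have h1 : (c.1, c.2) ∈ μ := hc
    have h2 := YoungDiagram.mem_iff_lt_colLen.1 (μ.up_left_mem le_rfl (Nat.zero_le c.2) h1)
    exact Finset.mem_range.2 (by omega)
  rw [YoungDiagram.card, Finset.card_eq_sum_card_fiberwise hmaps]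
  refine Finset.sum_congr rfl fun i _ => ?_
  rw [YoungDiagram.rowLen_eq_card]
  rfl

theorem sum_beads (h : μ.colLen 0 ≤ L) : ∑ x ∈ beads L μ, x = μ.card + L.choose 2 := by
  rw [beads, Finset.sum_image beadPos_injOn, card_eq_sum_rowLen h]
  simp only [beadPos]
  rw [Finset.sum_add_distrib, Finset.sum_range_reflect (fun i => i) L, Finset.sum_range_id,
    Nat.choose_two_right]

/-- Bead positions decrease strictly with the row, so the rank of a bead recovers its row; this
makes the bead set determine the partition. -/
theorem card_filter_lt_beads {i : ℕ} (hi : i < L) :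
    ((beads L μ).filter (beadPos L μ i < ·)).card = i := by
  have : (beads L μ).filter (beadPos L μ i < ·) = (Finset.range i).image (beadPos L μ) := by
    ext x
    simp only [Finset.mem_filter, mem_beads, Finset.mem_image, Finset.mem_range]
    constructor
    · rintro ⟨⟨k, hk, rfl⟩, h⟩
      refine ⟨k, ?_, rfl⟩
      by_contra hik
      rcases (not_lt.1 hik).eq_or_lt with h' | h'
      · subst h'; exact lt_irrefl _ h
      · exact lt_asymm h (beadPos_lt h' hk)
    · rintro ⟨k, hk, rfl⟩
      exact ⟨⟨k, by omega, rfl⟩, beadPos_lt hk hi⟩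
  rw [this, Finset.card_image_of_injOn, Finset.card_range]
  exact beadPos_injOn.mono (by simpa using hi.le)

theorem beads_injOn : Set.InjOn (beads L) {μ | μ.colLen 0 ≤ L} := by
  intro μ hμ ν hν h
  have key : ∀ i < L, μ.rowLen i = ν.rowLen i := fun i hi => by
    have h1 : beadPos L μ i ∈ beads L ν := h ▸ mem_beads.2 ⟨i, hi, rfl⟩
    obtain ⟨k, hk, hki⟩ := mem_beads.1 h1
    have h2 := card_filter_lt_beads (μ := μ) hi
    have h3 := card_filter_lt_beads (μ := ν) hk
    rw [hki, ← h, h2] at h3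
    subst h3
    simp only [beadPos] at hki
    omega
  have zero : ∀ {μ : YoungDiagram}, μ.colLen 0 ≤ L → ∀ i, L ≤ i → μ.rowLen i = 0 :=
      fun {μ} hμ i hi => by
    by_contra h0
    have h1 := YoungDiagram.mem_iff_lt_rowLen.2 (Nat.pos_of_ne_zero h0)
    have h2 := YoungDiagram.mem_iff_lt_colLen.1 h1
    omega
  ext ⟨i, j⟩
  rw [YoungDiagram.mem_cells, YoungDiagram.mem_cells, YoungDiagram.mem_iff_lt_rowLen,
    YoungDiagram.mem_iff_lt_rowLen]
  rcases lt_or_ge i L with hi | hi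
  · rw [key i hi]
  · rw [zero hμ i hi, zero hν i hi]

/-- Every `L`-element set of natural numbers is the set of beads of a partition. -/
theorem exists_beads_eq {X : Finset ℕ} (hX : X.card = L) :
    ∃ μ : YoungDiagram, μ.colLen 0 ≤ L ∧ beads L μ = X := by
  -- `x i` is the element of `X` with exactly `i` larger ones; only `i < L` matters. Row `i` of the
  -- diagram gets length `x i - (L - 1 - i)`.
  let x : ℕ → ℕ := fun i => if h : L - 1 - i < L then X.orderEmbOfFin hX ⟨L - 1 - i, h⟩ else 0
  have hx : ∀ i (h : L - 1 - i < L), x i = X.orderEmbOfFin hX ⟨L - 1 - i, h⟩ := fun i h => dif_pos h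
  have hlt : ∀ i k, i < k → k < L → x k < x i := fun i k hik hk => by
    rw [hx i (by omega), hx k (by omega)]
    exact (X.orderEmbOfFin hX).strictMono (Fin.mk_lt_mk.2 (by omega))
  have hmono : ∀ d i, i + d < L → x (i + d) + d ≤ x i := fun d => by
    induction d with
    | zero => simp
    | succ d ih =>
      intro i h
      have h1 := ih i (by omega)
      have h2 := hlt (i + d) (i + (d + 1)) (by omega) h
      omega
  let B := ∑ y ∈ X, y
  have hB : ∀ i < L, x i ≤ B := fun i hi => by
    rw [hx i (by omega)]
    exact Finset.single_le_sum (f := fun y => y) (fun _ _ => Nat.zero_le _)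
      (X.orderEmbOfFin_mem hX _)
  let μ : YoungDiagram :=
    { cells := (Finset.range L ×ˢ Finset.range (B + 1)).filter
        fun c => c.2 + (L - 1 - c.1) < x c.1
      isLowerSet := by
        rintro ⟨i, j⟩ ⟨i', j'⟩ ⟨hi, hj⟩ hc
        simp only [Finset.coe_filter, Finset.mem_product, Finset.mem_range, Set.mem_ofPred_eq]
          at hc hi hj ⊢
        have h1 := hmono (i - i') i' (by omega)
        rw [Nat.add_sub_cancel' hi] at h1
        exact ⟨⟨by omega, by omega⟩, by omega⟩ }
  have hmem : ∀ i j, (i, j) ∈ μ ↔ i < L ∧ j + (L - 1 - i) < x i := fun i j => by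
    rw [← YoungDiagram.mem_cells]
    simp only [μ, Finset.mem_filter, Finset.mem_product, Finset.mem_range]
    constructor
    · rintro ⟨⟨h1, -⟩, h2⟩
      exact ⟨h1, h2⟩
    · rintro ⟨h1, h2⟩
      have := hB i h1
      exact ⟨⟨h1, by omega⟩, h2⟩
  have hpos : ∀ i < L, beadPos L μ i = x i := fun i hi => by
    have h1 := hmono (L - 1 - i) i (by omega)
    have h2 := (hmem i (μ.rowLen i)).not.1 (by rw [YoungDiagram.mem_iff_lt_rowLen]; omega)
    rw [beadPos]
    rcases Nat.eq_zero_or_pos (μ.rowLen i) with h0 | h0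
    · rw [h0] at h2 ⊢
      simp only [hi, true_and] at h2
      omega
    · have h3 := (hmem i (μ.rowLen i - 1)).1
        (YoungDiagram.mem_iff_lt_rowLen.2 (by omega))
      simp only [hi, true_and] at h2
      omega
  refine ⟨μ, ?_, ?_⟩
  · by_contra h
    have h1 : (L, 0) ∈ μ := YoungDiagram.mem_iff_lt_colLen.2 (by omega)
    exact absurd ((hmem _ _).1 h1).1 (lt_irrefl _)
  · refine Finset.eq_of_subset_of_card_le (fun y hy => ?_) (by rw [card_beads, hX])
    obtain ⟨i, hi, rfl⟩ := mem_beads.1 hy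
    rw [hpos i hi, hx i (by omega)]
    exact X.orderEmbOfFin_mem hX _

theorem colLen_le (h : μ.colLen 0 ≤ L) (j : ℕ) : μ.colLen j ≤ L :=
  (μ.colLen_anti 0 j (Nat.zero_le j)).trans h

/-- The positions without a bead correspond to the columns. -/
theorem notMem_beads_iff (h : μ.colLen 0 ≤ L) {y : ℕ} :
    y ∉ beads L μ ↔ ∃ j, y + μ.colLen j = j + L := by
  constructor
  · intro hy
    have hy' : ∀ i < L, beadPos L μ i ≠ y := fun i hi he => hy (mem_beads.2 ⟨i, hi, he⟩)
    -- The least such `i` counts the beads above the gap `y`, and it is the length of the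
    -- corresponding column.
    have hex : ∃ i, L ≤ i ∨ beadPos L μ i < y := ⟨L, Or.inl le_rfl⟩
    classical
    obtain ⟨i, hi, hmin⟩ : ∃ i, (L ≤ i ∨ beadPos L μ i < y) ∧
        ∀ k < i, ¬ (L ≤ k ∨ beadPos L μ k < y) :=
      ⟨Nat.find hex, Nat.find_spec hex, fun k hk => Nat.find_min hex hk⟩
    have hiL : i ≤ L := by
      by_contra hlt
      exact hmin L (by omega) (Or.inl le_rfl)
    have hyi : L - i ≤ y := by
      rcases hi with hi | hi
      · omega
      · simp only [beadPos] at hi; omega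
    refine ⟨y - (L - i), ?_⟩
    have hc : μ.colLen (y - (L - i)) = i := by
      apply le_antisymm
      · by_contra hlt
        have h1 := YoungDiagram.mem_iff_lt_rowLen.1
          (YoungDiagram.mem_iff_lt_colLen.2 (not_le.1 hlt))
        have h2 := colLen_le h (y - (L - i))
        rcases hi with hi | hi
        · omega
        · simp only [beadPos] at hi; omega
      · rcases Nat.eq_zero_or_pos i with rfl | hpos
        · exact Nat.zero_le _
        · have h1 := hmin (i - 1) (by omega)
          have h2 := hy' (i - 1) (by omega)
          simp only [beadPos] at h1 h2
          have h3 : (i - 1, y - (L - i)) ∈ μ := YoungDiagram.mem_iff_lt_rowLen.2 (by omega)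
          have := YoungDiagram.mem_iff_lt_colLen.1 h3
          omega
    omega
  · rintro ⟨j, hj⟩ hy
    obtain ⟨i, hi, rfl⟩ := mem_beads.1 hy
    simp only [beadPos] at hj
    by_cases hm : (i, j) ∈ μ
    · have h1 := YoungDiagram.mem_iff_lt_rowLen.1 hm
      have h2 := YoungDiagram.mem_iff_lt_colLen.1 hm
      omega
    · have h1 := YoungDiagram.mem_iff_lt_rowLen.not.1 hm
      have h2 := YoungDiagram.mem_iff_lt_colLen.not.1 hm
      omega

/-- The hook numbers are the differences between beads and smaller free positions. -/
theorem exists_hookNumber_eq_iff (h : μ.colLen 0 ≤ L) {i m : ℕ} (hi : i < L) (hm : 0 < m) :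
    (∃ j, (i, j) ∈ μ ∧ hookNumber μ i j = m) ↔
      ∃ y, y ∉ beads L μ ∧ y + m = beadPos L μ i := by
  constructor
  · rintro ⟨j, hj, rfl⟩
    have h1 := YoungDiagram.mem_iff_lt_rowLen.1 hj
    have h2 := YoungDiagram.mem_iff_lt_colLen.1 hj
    have h3 := colLen_le h j
    refine ⟨j + L - μ.colLen j, (notMem_beads_iff h).2 ⟨j, by omega⟩, ?_⟩
    simp only [beadPos, hookNumber]
    omega
  · rintro ⟨y, hy, he⟩
    obtain ⟨j, hj⟩ := (notMem_beads_iff h).1 hy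
    simp only [beadPos] at he
    have hmem : (i, j) ∈ μ := by
      by_contra hn
      have h1 := YoungDiagram.mem_iff_lt_rowLen.not.1 hn
      have h2 := YoungDiagram.mem_iff_lt_colLen.not.1 hn
      omega
    have h1 := YoungDiagram.mem_iff_lt_rowLen.1 hmem
    have h2 := YoungDiagram.mem_iff_lt_colLen.1 hmem
    have h3 := colLen_le h j
    refine ⟨j, hmem, ?_⟩
    simp only [hookNumber]
    omega

/-- Hooks are distances from a bead down to a gap. If a gap lies a multiple of `t` below a bead,
then somewhere between them a single step of `t` leads from a bead to a gap, so testing distance `t`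
suffices. -/
theorem isCore_iff_beads (h : μ.colLen 0 ≤ L) {t : ℕ} (ht : 0 < t) :
    IsCore t μ ↔ ∀ y, y + t ∈ beads L μ → y ∈ beads L μ := by
  constructor
  · intro hc y hy
    by_contra hn
    obtain ⟨i, hi, he⟩ := mem_beads.1 hy
    obtain ⟨j, hj, hh⟩ := (exists_hookNumber_eq_iff h hi ht).2 ⟨y, hn, he.symm⟩
    exact hc i j hj (hh ▸ dvd_rfl)
  · rintro hc i j hj ⟨m, hm⟩
    have hi : i < L := by
      have := YoungDiagram.mem_iff_lt_colLen.1 hj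
      have := colLen_le h j
      omega
    obtain ⟨y, hy, he⟩ := (exists_hookNumber_eq_iff h hi (m := t * m)
      (by rw [← hm, hookNumber]; omega)).1 ⟨j, hj, hm⟩
    have key : ∀ m y, y + t * m ∈ beads L μ → y ∈ beads L μ := fun m => by
      induction m with
      | zero => intro y; simp
      | succ m ih =>
        intro y h'
        exact hc y (ih (y + t) (by rwa [add_assoc, add_comm t, ← Nat.mul_succ]))
    exact hy (key m y (he ▸ mem_beads.2 ⟨i, hi, rfl⟩))

end beads

/-! ### Cores on the abacus. -/

section abacus

variable {t : ℕ}

/-- The set of beads on the abacus with `t` runners whose runner `j` has its `c j` first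
positions filled. -/
def abacus (c : Fin t → ℕ) : Finset ℕ :=
  Finset.univ.biUnion fun j => (Finset.range (c j)).image fun m => t * m + j

theorem mem_abacus (ht : 0 < t) {c : Fin t → ℕ} {x : ℕ} :
    x ∈ abacus c ↔ x / t < c ⟨x % t, Nat.mod_lt x ht⟩ := by
  simp only [abacus, Finset.mem_biUnion, Finset.mem_univ, true_and, Finset.mem_image,
    Finset.mem_range]
  constructor
  · rintro ⟨j, m, hm, rfl⟩
    have h1 : (t * m + j) / t = m := by
      rw [Nat.mul_add_div ht, Nat.div_eq_of_lt j.2, add_zero]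
    have h2 : (⟨(t * m + j) % t, Nat.mod_lt _ ht⟩ : Fin t) = j :=
      Fin.ext (by simp [Nat.mod_eq_of_lt j.2])
    rwa [h1, h2]
  · intro h
    exact ⟨⟨x % t, Nat.mod_lt x ht⟩, x / t, h, Nat.div_add_mod x t⟩

theorem sum_abacus {M : Type*} [AddCommMonoid M] (c : Fin t → ℕ) (f : ℕ → M) :
    ∑ x ∈ abacus c, f x = ∑ j, ∑ m ∈ Finset.range (c j), f (t * m + j) := by
  rw [abacus, Finset.sum_biUnion]
  · refine Finset.sum_congr rfl fun j _ => Finset.sum_image fun a _ b _ h => ?_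
    have ht : 0 < t := j.pos
    exact Nat.eq_of_mul_eq_mul_left ht (by simpa using h)
  · intro i _ j _ hij
    rw [Function.onFun, Finset.disjoint_left]
    intro x hx hy
    simp only [Finset.mem_image] at hx hy
    obtain ⟨a, -, rfl⟩ := hx
    obtain ⟨b, -, h⟩ := hy
    apply hij
    have := congrArg (· % t) h
    simp only [Nat.mul_add_mod, Nat.mod_eq_of_lt i.2, Nat.mod_eq_of_lt j.2] at this
    exact Fin.ext this.symm

theorem card_abacus (c : Fin t → ℕ) : (abacus c).card = ∑ j, c j := by
  rw [Finset.card_eq_sum_ones, sum_abacus]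
  simp

/-- The sum of the positions of the beads of an abacus. -/
def abacusEnergy (c : Fin t → ℕ) : ℕ := ∑ j : Fin t, (t * (c j).choose 2 + j * c j)

theorem sum_abacus_id (c : Fin t → ℕ) : ∑ x ∈ abacus c, x = abacusEnergy c := by
  rw [sum_abacus, abacusEnergy]
  refine Finset.sum_congr rfl fun j _ => ?_
  rw [Finset.sum_add_distrib, ← Finset.mul_sum, Finset.sum_range_id, Nat.choose_two_right]
  simp [mul_comm]

theorem abacus_injective (ht : 0 < t) : Function.Injective (abacus : (Fin t → ℕ) → Finset ℕ) := by
  intro c d h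
  have key : ∀ j m, m < c j ↔ m < d j := fun j m => by
    have h1 := mem_abacus ht (c := c) (x := t * m + j)
    have h2 := mem_abacus ht (c := d) (x := t * m + j)
    have e1 : (t * m + j) / t = m := by
      rw [Nat.mul_add_div ht, Nat.div_eq_of_lt j.2, add_zero]
    have e2 : (⟨(t * m + j) % t, Nat.mod_lt _ ht⟩ : Fin t) = j :=
      Fin.ext (by simp [Nat.mod_eq_of_lt j.2])
    rw [e1, e2] at h1 h2
    rw [← h1, ← h2, h]
  funext j
  have h1 := key j (c j)
  have h2 := key j (d j)
  omega

theorem exists_abacus_eq (ht : 0 < t) {X : Finset ℕ} (hX : ∀ y, y + t ∈ X → y ∈ X) :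
    ∃ c : Fin t → ℕ, abacus c = X := by
  -- The first gap on each runner is its number of beads, because nothing lies above a gap of a set
  -- closed under sliding down.
  have hex : ∀ j : Fin t, ∃ m, t * m + j ∉ X := fun j => by
    obtain ⟨b, hb⟩ := X.bddAbove
    refine ⟨b + 1, fun h => ?_⟩
    have := hb h
    nlinarith
  classical
  have hdown : ∀ d y, y + t * d ∈ X → y ∈ X := fun d => by
    induction d with
    | zero => intro y; simp
    | succ d ih =>
      intro y h
      exact hX y (ih (y + t) (by rwa [add_assoc, add_comm t, ← Nat.mul_succ]))
  refine ⟨fun j => Nat.find (hex j), ?_⟩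
  ext x
  rw [mem_abacus ht, Nat.lt_find_iff]
  constructor
  · intro h
    have := h (x / t) le_rfl
    rwa [not_not, Nat.div_add_mod] at this
  · intro hx m hm
    rw [not_not]
    apply hdown (x / t - m)
    convert hx using 1
    have := Nat.div_add_mod x t
    obtain ⟨d, hd⟩ := Nat.exists_eq_add_of_le hm
    rw [hd] at this ⊢
    rw [Nat.add_sub_cancel_left]
    simp only
    linarith [mul_add t m d]

theorem abacus_closed (ht : 0 < t) (c : Fin t → ℕ) {y : ℕ} (h : y + t ∈ abacus c) :
    y ∈ abacus c := by
  rw [mem_abacus ht] at h ⊢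
  simp only [Nat.add_mod_right, Nat.add_div_right y ht] at h
  omega

/-- The `t`-cores of `N` correspond to the `t`-tuples of natural numbers with sum `L ≥ N` and
energy `N + L (L - 1) / 2`. -/
theorem ncard_isCore_eq (ht : 0 < t) {N : ℕ} (L : ℕ) (hN : N ≤ L) :
    {μ : YoungDiagram | IsCore t μ ∧ μ.card = N}.ncard =
      {c : Fin t → ℕ | ∑ j, c j = L ∧ abacusEnergy c = N + L.choose 2}.ncard := by
  have hcol : ∀ μ : YoungDiagram, μ.card = N → μ.colLen 0 ≤ L := fun μ hμ => by
    rw [YoungDiagram.colLen_eq_card]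
    exact (Finset.card_filter_le _ _).trans (hμ.le.trans hN)
  rw [← Set.InjOn.ncard_image (f := beads L)
      (beads_injOn.mono fun μ hμ => hcol μ hμ.2),
    ← Set.ncard_image_of_injective _ (abacus_injective ht)]
  congr 1
  ext X
  simp only [Set.mem_image, Set.mem_ofPred_eq]
  constructor
  · rintro ⟨μ, ⟨hc, hμ⟩, rfl⟩
    obtain ⟨c, hcX⟩ := exists_abacus_eq ht ((isCore_iff_beads (hcol μ hμ) ht).1 hc)
    refine ⟨c, ⟨?_, ?_⟩, hcX⟩
    · rw [← card_abacus, hcX, card_beads]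
    · rw [← sum_abacus_id, hcX, sum_beads (hcol μ hμ), hμ]
  · rintro ⟨c, ⟨hs, he⟩, rfl⟩
    obtain ⟨μ, hμL, hμ⟩ := exists_beads_eq ((card_abacus c).trans hs)
    refine ⟨μ, ⟨(isCore_iff_beads hμL ht).2 fun y hy => ?_, ?_⟩, hμ⟩
    · rw [hμ] at hy ⊢
      exact abacus_closed ht c hy
    · have := sum_beads hμL
      rw [hμ, sum_abacus_id, he] at this
      omega

end abacus

/-! ### The generating function of t-cores. -/

theorem prod_range_mul_eq {M : Type*} [CommMonoid M] (t n : ℕ) (f : ℕ → M) :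
    ∏ i ∈ Finset.range (t * n), f i = ∏ j : Fin t, ∏ i ∈ Finset.range n, f (t * i + j) := by
  induction n with
  | zero => simp
  | succ n ih =>
    simp only [Finset.prod_range_succ, Finset.prod_mul_distrib]
    rw [Nat.mul_succ, Finset.prod_range_add, ih, Finset.prod_range]

/-- The tuples of `t` numbers at most `n` with sum `L`. -/
def boxTuples (t n L : ℕ) : Finset (Fin t → ℕ) :=
  (Fintype.piFinset fun _ => Finset.range (n + 1)).filter fun c => ∑ j, c j = L

theorem mem_boxTuples {t n L : ℕ} {c : Fin t → ℕ} :
    c ∈ boxTuples t n L ↔ (∀ j, c j ≤ n) ∧ ∑ j, c j = L := by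
  simp [boxTuples]

/-- Sorting the beads by runners turns a Gaussian binomial coefficient into a sum of products. -/
theorem gaussBinom_mul_eq_sum {R : Type*} [CommRing R] (q : R) (t n L : ℕ) (hL : L ≤ t * n) :
    gaussBinom q (t * n) L * q ^ L.choose 2 =
      ∑ c ∈ boxTuples t n L, (∏ j, gaussBinom (q ^ t) n (c j)) * q ^ abacusEnergy c := by
  -- A formal variable marks the number of beads; the identity is the comparison of coefficients at
  -- its `L`-th power.
  have h1 := prod_add_mul_pow (Polynomial.C q) 1 (Polynomial.X : Polynomial R) (t * n)
  have h2 : ∀ j : Fin t, ∏ i ∈ Finset.range n,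
      (1 + (Polynomial.X : Polynomial R) * Polynomial.C q ^ (t * i + j)) =
      ∑ k ∈ Finset.range (n + 1), Polynomial.C (gaussBinom (q ^ t) n k *
        q ^ (t * k.choose 2 + j * k)) * Polynomial.X ^ k := fun j => by
    have := prod_add_mul_pow (Polynomial.C q ^ t) 1
      ((Polynomial.X : Polynomial R) * Polynomial.C q ^ (j : ℕ)) n
    have e : ∏ i ∈ Finset.range n,
        (1 + (Polynomial.X : Polynomial R) * Polynomial.C q ^ (t * i + j)) =
        ∏ i ∈ Finset.range n, (1 + (Polynomial.X : Polynomial R) * Polynomial.C q ^ (j : ℕ) *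
          (Polynomial.C q ^ t) ^ i) :=
      Finset.prod_congr rfl fun i _ => by ring
    rw [e, this]
    refine Finset.sum_congr rfl fun k _ => ?_
    rw [← map_pow, ← map_gaussBinom]
    simp only [map_mul, map_pow, one_pow, mul_one]
    ring
  rw [prod_range_mul_eq, Finset.prod_congr rfl fun j _ => h2 j, Finset.prod_univ_sum] at h1
  have h3 := congrArg (fun p => Polynomial.coeff p L) h1
  simp only [Finset.prod_mul_distrib, Finset.prod_pow_eq_pow_sum, ← map_prod, ← map_gaussBinom,
    ← map_pow, ← map_mul, one_pow, mul_one, Polynomial.finsetSum_coeff,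
    Polynomial.coeff_C_mul_X_pow] at h3
  rw [Finset.sum_ite_eq, if_pos (Finset.mem_range.2 (by omega))] at h3
  rw [← h3, boxTuples, Finset.sum_filter]
  refine Finset.sum_congr rfl fun c _ => ?_
  simp only [eq_comm (a := L), abacusEnergy]

/-- The energy grows with the distance from the balanced tuple. -/
theorem natAbs_le_abacusEnergy {t M : ℕ} {c : Fin t → ℕ} (hc : ∑ j, c j = t * M) (i : Fin t) :
    (t * M).choose 2 + ((c i : ℤ) - M).natAbs ≤ abacusEnergy c := by
  have ht : 1 ≤ t := i.pos
  let d : Fin t → ℤ := fun j => (c j : ℤ) - M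
  have hd : ∑ j, d j = 0 := by
    simp only [d, Finset.sum_sub_distrib]
    rw [← Nat.cast_sum, hc]
    simp
  have hj : ∑ j : Fin t, (2 * (j : ℤ)) = t * (t - 1) := by
    have h := Finset.sum_range_id_mul_two t
    rw [Finset.sum_range] at h
    rw [← Finset.mul_sum]
    zify [ht] at h
    linarith
  have he : 2 * (abacusEnergy c : ℤ) =
      2 * ((t * M).choose 2 : ℤ) + ∑ j : Fin t, (t * d j ^ 2 + (2 * j - (t - 1)) * d j) := by
    have h1 : ∀ j : Fin t, 2 * ((t * (c j).choose 2 + j * c j : ℕ) : ℤ) =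
        (t * d j ^ 2 + (2 * j - (t - 1)) * d j) + (2 * t * M - 1) * d j
          + (t * M * (M - 1) + M * (2 * (j : ℤ))) := fun j => by
      have := choose_two_cast (c j)
      simp only [d]
      push_cast
      linear_combination (t : ℤ) * this
    have h2 : ∑ j, (2 * (t : ℤ) * M - 1) * d j = 0 := by rw [← Finset.mul_sum, hd, mul_zero]
    have h3 : ∑ j : Fin t, ((t : ℤ) * M * (M - 1) + M * (2 * (j : ℤ))) =
        t * (t * M * (M - 1)) + M * (t * (t - 1)) := by
      rw [Finset.sum_add_distrib, Finset.sum_const, ← Finset.mul_sum, hj]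
      simp
    rw [abacusEnergy, Nat.cast_sum, Finset.mul_sum, Finset.sum_congr rfl fun j _ => h1 j,
      Finset.sum_add_distrib, Finset.sum_add_distrib, h2, h3, choose_two_cast]
    push_cast
    ring
  -- For integers `d j ^ 2 ≥ |d j|`, and the linear coefficient is at most `t - 1` in absolute
  -- value, which leaves one `|d j|` to spare.
  have hb : ∀ j : Fin t, |d j| ≤ t * d j ^ 2 + (2 * j - (t - 1)) * d j := fun j => by
    have h1 : (j : ℤ) + 1 ≤ t := by exact_mod_cast j.2
    have h2 : (0 : ℤ) ≤ j := by positivity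
    have h3 : |d j| ≤ d j ^ 2 := by
      rcases eq_or_ne (d j) 0 with h | h
      · simp [h]
      · rw [← sq_abs]
        nlinarith [Int.one_le_abs h]
    have h4 : -((t - 1) * |d j|) ≤ (2 * j - (t - 1)) * d j := by
      rcases abs_cases (d j) with ⟨h, h'⟩ | ⟨h, h'⟩ <;> rw [h] <;> nlinarith
    nlinarith
  -- As the deviations sum to zero, the others must compensate `d i`; this supplies the factor 2.
  have hs : 2 * |d i| ≤ ∑ j, |d j| := by
    have h1 := Finset.add_sum_erase Finset.univ d (Finset.mem_univ i)
    have h2 := Finset.add_sum_erase Finset.univ (fun j => |d j|) (Finset.mem_univ i)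
    have h3 := Finset.abs_sum_le_sum_abs d (Finset.univ.erase i)
    rw [hd] at h1
    have h4 : ∑ j ∈ Finset.univ.erase i, d j = -d i := by linarith
    rw [h4, abs_neg] at h3
    linarith
  have hsum := hs.trans (Finset.sum_le_sum fun j _ => hb j)
  have : (((c i : ℤ) - M).natAbs : ℤ) = |d i| := Int.natCast_natAbs _
  zify
  rw [← Int.natCast_natAbs, this]
  linarith

/-- The generating function of `t`-cores. -/
noncomputable def coreSeries (t : ℕ) : ℤ⟦X⟧ :=
  genSeries fun μ : {μ : YoungDiagram // IsCore t μ} => μ.1.card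

theorem coeff_coreSeries (t N : ℕ) :
    coeff N (coreSeries t) = ({μ : YoungDiagram | IsCore t μ ∧ μ.card = N}.ncard : ℤ) := by
  rw [coreSeries, genSeries, coeff_mk, ← Nat.card_coe_set_eq]
  congr 1
  exact Nat.card_congr (Equiv.subtypeSubtypeEquivSubtypeInter (IsCore t)
    fun μ : YoungDiagram => μ.card = N)

/-- Below this order the energy bound forces every entry within `M` of the balanced value `M`, so
the box `2 * M` omits nothing, and `t * M` beads suffice for every partition that occurs. -/
theorem X_pow_dvd_sum_sub_coreSeries {t : ℕ} (ht : 0 < t) (M : ℕ) :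
    (X : ℤ⟦X⟧) ^ ((t * M).choose 2 + M) ∣
      ∑ c ∈ boxTuples t (2 * M) (t * M), X ^ abacusEnergy c -
        X ^ (t * M).choose 2 * coreSeries t := by
  rw [X_pow_dvd_iff]
  intro d hd
  rw [map_sub, sub_eq_zero, map_sum, coeff_X_pow_mul']
  simp only [coeff_X_pow]
  rw [Finset.sum_boole]
  split_ifs with h
  · rw [coeff_coreSeries, ncard_isCore_eq ht (N := d - (t * M).choose 2) (t * M)
        (le_trans (by omega) (Nat.le_mul_of_pos_left M ht)),
      Nat.sub_add_cancel h, ← Set.ncard_coe_finset]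
    congr 2
    ext c
    simp only [Finset.coe_filter, mem_boxTuples, Set.mem_ofPred_eq]
    constructor
    · rintro ⟨⟨-, h1⟩, h2⟩
      exact ⟨h1, h2.symm⟩
    · rintro ⟨h1, h2⟩
      refine ⟨⟨fun j => ?_, h1⟩, h2.symm⟩
      have := natAbs_le_abacusEnergy h1 j
      omega
  · rw [Nat.cast_eq_zero, Finset.card_eq_zero, Finset.filter_eq_empty_iff]
    intro c hc he
    have := natAbs_le_abacusEnergy (mem_boxTuples.1 hc).2 ⟨0, ht⟩
    omega

/-- The generating function of `t`-cores is `∏ (1 - q^{tn})^t / (1 - q^n)`. -/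
theorem eulerProd_one_mul_coreSeries {t : ℕ} (ht : 0 < t) :
    eulerProd 1 * coreSeries t = eulerProd t ^ t := by
  refine eq_of_X_pow_dvd_sub fun M => ?_
  have h1 := gaussBinom_mul_eq_sum (X : ℤ⟦X⟧) t (2 * M) (t * M)
    (Nat.mul_le_mul_left t (by omega))
  have h2 := X_pow_dvd_eulerProd_mul_gaussBinom_sub_one (k := 1) le_rfl (t * M) (t * M)
  have e1 : t * M + t * M = t * (2 * M) := by ring
  rw [pow_one, min_self, e1] at h2
  have h3 : (X : ℤ⟦X⟧) ^ ((t * M).choose 2 + M) ∣ ∑ c ∈ boxTuples t (2 * M) (t * M),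
      (∏ j, eulerProd t * gaussBinom (X ^ t) (2 * M) (c j) - 1) * X ^ abacusEnergy c := by
    refine Finset.dvd_sum fun c hc => ?_
    obtain ⟨hb, hs⟩ := mem_boxTuples.1 hc
    -- Two errors balance: for a tuple at distance δ from the balanced one, the binomials are
    -- accurate only to order `M - δ`, but its energy is larger by at least δ.
    obtain ⟨i, -, hi⟩ := Finset.exists_max_image Finset.univ
      (fun j => ((c j : ℤ) - M).natAbs) ⟨⟨0, ht⟩, Finset.mem_univ _⟩
    have hi := fun j => hi j (Finset.mem_univ j)
    have hE := natAbs_le_abacusEnergy hs i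
    set δ := ((c i : ℤ) - M).natAbs with hδ
    have hd : (X : ℤ⟦X⟧) ^ (M - δ) ∣
        ∏ j, eulerProd t * gaussBinom (X ^ t) (2 * M) (c j) - 1 := by
      have h4 : ∀ j, (X : ℤ⟦X⟧) ^ (M - δ) ∣
          eulerProd t * gaussBinom (X ^ t) (2 * M) (c j) - 1 := fun j => by
        have h5 := X_pow_dvd_eulerProd_mul_gaussBinom_sub_one ht (2 * M - c j) (c j)
        rw [Nat.sub_add_cancel (hb j)] at h5
        refine (pow_dvd_pow _ ?_).trans h5
        have h6 : ((c j : ℤ) - M).natAbs ≤ δ := hi j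
        have h7 := hb j
        omega
      have h6 : ∀ s : Finset (Fin t), (X : ℤ⟦X⟧) ^ (M - δ) ∣
          ∏ j ∈ s, eulerProd t * gaussBinom (X ^ t) (2 * M) (c j) - 1 := fun s => by
        induction s using Finset.cons_induction with
        | empty => simp
        | cons a s ha ih =>
          rw [Finset.prod_cons]
          convert dvd_add (ih.mul_left (eulerProd t * gaussBinom (X ^ t) (2 * M) (c a))) (h4 a)
            using 1
          ring
      exact h6 _
    refine (pow_dvd_pow _ ?_).trans ((pow_add (X : ℤ⟦X⟧) (M - δ) (abacusEnergy c)).dvd.trans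
      (mul_dvd_mul hd dvd_rfl))
    omega
  have h4 := X_pow_dvd_sum_sub_coreSeries ht M
  have h5 : (X : ℤ⟦X⟧) ^ ((t * M).choose 2 + M) ∣ X ^ (t * M).choose 2 *
      (eulerProd 1 * gaussBinom X (t * (2 * M)) (t * M) - 1) := by
    rw [pow_add]
    exact mul_dvd_mul dvd_rfl ((pow_dvd_pow _ (by nlinarith)).trans h2)
  have h6 : ∑ c ∈ boxTuples t (2 * M) (t * M),
      (∏ j, eulerProd t * gaussBinom (X ^ t) (2 * M) (c j) - 1) * X ^ abacusEnergy c =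
      eulerProd t ^ t * (gaussBinom X (t * (2 * M)) (t * M) * X ^ (t * M).choose 2) -
        ∑ c ∈ boxTuples t (2 * M) (t * M), (X : ℤ⟦X⟧) ^ abacusEnergy c := by
    rw [h1, Finset.mul_sum, ← Finset.sum_sub_distrib]
    refine Finset.sum_congr rfl fun c _ => ?_
    rw [Finset.prod_mul_distrib, Finset.prod_const, Finset.card_univ, Fintype.card_fin]
    ring
  rw [h6] at h3
  have h7 : (X : ℤ⟦X⟧) ^ ((t * M).choose 2 + M) ∣
      X ^ (t * M).choose 2 * (eulerProd 1 * coreSeries t - eulerProd t ^ t) := by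
    have := dvd_sub ((h5.mul_left (eulerProd t ^ t)).sub (h3.mul_left (eulerProd 1)))
      (h4.mul_left (eulerProd 1))
    convert this using 1
    ring
  rw [pow_add] at h7
  exact (mul_dvd_mul_iff_left (pow_ne_zero _ X_ne_zero)).1 h7

/-! ### Coefficient relations for pairs of cores. -/

theorem coeff_coreSeries_sq (t n : ℕ) : coeff n (coreSeries t ^ 2) = (A t n : ℤ) := by
  have hfin : ∀ n, Finite {μ : {μ : YoungDiagram // IsCore t μ} // μ.1.card = n} := fun n =>
    have := (finite_card_le n).to_subtype
    Finite.of_injective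
      (fun μ : {μ : {μ : YoungDiagram // IsCore t μ} // μ.1.card = n} =>
        (⟨μ.1.1, μ.2.le⟩ : {μ : YoungDiagram | μ.card ≤ n}))
      fun μ ν h => by simpa [Subtype.ext_iff] using h
  rw [sq, coreSeries, genSeries_mul hfin hfin, genSeries, coeff_mk, A, ← Nat.card_coe_set_eq]
  congr 1
  exact Nat.card_congr
    { toFun := fun p => ⟨(p.1.1.1, p.1.2.1), p.1.1.2, p.1.2.2, p.2⟩
      invFun := fun p => ⟨(⟨p.1.1, p.2.1⟩, ⟨p.1.2, p.2.2.1⟩), p.2.2.2⟩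
      left_inv := fun _ => rfl
      right_inv := fun _ => rfl }

theorem coeff_X_mul_coreSeries_sq (n : ℕ) :
    coeff (n + 2) ((X * coreSeries 5) ^ 2) = (A 5 n : ℤ) := by
  rw [mul_pow, coeff_X_pow_mul, coeff_coreSeries_sq]

/-- The coefficient of `f` at an even index, if the even part of `f` is `g (q²)`. -/
theorem coeff_two_mul_of_even_part {f g : ℤ⟦X⟧}
    (h : f + rescale (-1 : ℤ) f = expand 2 two_ne_zero (2 * g)) (n : ℕ) :
    coeff (2 * n) f = coeff n g := by
  have := congrArg (coeff (2 * n)) h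
  have e : (2 : ℤ⟦X⟧) * g = PowerSeries.C (2 : ℤ) * g := by simp
  rw [coeff_expand_mul, map_add, coeff_rescale, pow_mul, neg_one_sq, one_pow, one_mul, e,
    coeff_C_mul] at this
  omega

theorem coeff_C_mul_cast (a : ℤ) (f : ℤ⟦X⟧) (n : ℕ) :
    coeff n ((a : ℤ⟦X⟧) * f) = a * coeff n f := by
  rw [← coeff_C_mul]
  simp

theorem coeff_relation (n : ℕ) :
    coeff (2 * n) ((X * coreSeries 5) ^ 2) = 9 * coeff n ((X * coreSeries 5) ^ 2) +
      coeff n cuspSeries - 8 * coeff n (expand 2 two_ne_zero ((X * coreSeries 5) ^ 2)) := by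
  have h := even_parts_coreSeries (eulerProd_one_mul_coreSeries (t := 5) (by norm_num))
  have h9 := coeff_C_mul_cast 9 ((X * coreSeries 5) ^ 2) n
  have h8 := coeff_C_mul_cast 8 (expand 2 two_ne_zero ((X * coreSeries 5) ^ 2)) n
  push_cast at h9 h8
  rw [coeff_two_mul_of_even_part h.1, map_sub, map_add, h9, h8]

theorem coeff_cuspSeries_relation (n : ℕ) :
    coeff (2 * n) cuspSeries = -4 * coeff n cuspSeries -
      8 * coeff n (expand 2 two_ne_zero cuspSeries) := by
  have h := even_parts_coreSeries (eulerProd_one_mul_coreSeries (t := 5) (by norm_num))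
  have h4 := coeff_C_mul_cast (-4) cuspSeries n
  have h8 := coeff_C_mul_cast 8 (expand 2 two_ne_zero cuspSeries) n
  push_cast at h4 h8
  rw [coeff_two_mul_of_even_part h.2, map_sub, h4, h8]

/-! ### Solving the recurrences. -/

theorem seven_mul_div (k : ℕ) : 7 * (((8 : ℤ) ^ k - 1) / 7) = 8 ^ k - 1 :=
  Int.mul_ediv_cancel' (seven_dvd k)

/-- Solution of the linear recurrence satisfied by the coefficients at `2 ^ k * m` for odd `m`. -/
theorem eq_B_mul_add {F S : ℕ → ℤ} (hF1 : F 1 = 9 * F 0 + S 0)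
    (hF : ∀ k, F (k + 2) = 9 * F (k + 1) + S (k + 1) - 8 * F k) (hS1 : S 1 = -4 * S 0)
    (hS : ∀ k, S (k + 2) = -4 * S (k + 1) - 8 * S k) (k : ℕ) :
    F k = B k * F 1 + ((8 ^ (k + 1) - 1) / 7 - 9 * B k) * F 0 := by
  -- This combination removes the cusp eigenvalue -4: it satisfies G(k+2) = 9 G(k+1) - 8 G(k), with
  -- characteristic roots 1 and 8 and G(0) = F 1 + 4 * F 0.
  have hG : ∀ k, S k + 13 * F k = (8 ^ (k + 1) - 1) / 7 * (F 1 + 4 * F 0) := fun k => by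
    induction k using Nat.twoStepInduction with
    | zero => norm_num; linear_combination -hF1
    | one => norm_num; linear_combination hS1 + 4 * hF1
    | more k ih1 ih2 =>
      have a := seven_mul_div (k + 1)
      have b := seven_mul_div (k + 1 + 1)
      have c := seven_mul_div (k + 2 + 1)
      apply mul_left_cancel₀ (by norm_num : (7 : ℤ) ≠ 0)
      rw [hF, hS]
      linear_combination 63 * ih2 - 56 * ih1 +
        (F 1 + 4 * F 0) * (9 * b - 8 * a - c)
  induction k using Nat.twoStepInduction with
  | zero => simp [B]
  | one => norm_num [B]
  | more k ih1 ih2 =>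
    have a := seven_mul_div (k + 1)
    have b := seven_mul_div (k + 1 + 1)
    have c := seven_mul_div (k + 2 + 1)
    have hB : B (k + 2) = -4 * B (k + 1) - 8 * B k + (8 ^ (k + 2) - 1) / 7 := rfl
    have hg := hG (k + 1)
    apply mul_left_cancel₀ (by norm_num : (7 : ℤ) ≠ 0)
    rw [hF, hB]
    -- Replacing `S` by G - 13F turns 9F + S into -4F + G, which is the recurrence of `B` with a
    -- multiple of its inhomogeneous term.
    linear_combination 7 * hg - 28 * ih2 - 56 * ih1 + F 0 * (-4 * b - 8 * a - c + 13 * b)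

theorem A_five_eq (n k : ℕ) :
    (A 5 (2 ^ (k + 1) * n + 3 * 2 ^ k - 2) : ℤ) = B k * (A 5 (4 * n + 4) : ℤ) +
      ((8 ^ (k + 1) - 1) / 7 - 9 * B k) * (A 5 (2 * n + 1) : ℤ) := by
  -- At the odd index `2 * n + 3` the term in q^2 vanishes, which gives the shorter first step of
  -- each recurrence.
  have hodd : ∀ f : ℤ⟦X⟧, coeff (2 * n + 3) (expand 2 two_ne_zero f) = 0 := fun f =>
    coeff_expand_of_not_dvd 2 two_ne_zero f (by omega)
  have hexp : ∀ (f : ℤ⟦X⟧) (k : ℕ), coeff (2 ^ (k + 1) * (2 * n + 3)) (expand 2 two_ne_zero f) =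
      coeff (2 ^ k * (2 * n + 3)) f := fun f k => by
    rw [pow_succ', mul_assoc, coeff_expand_mul]
  have hstep : ∀ k, 2 ^ (k + 1) * (2 * n + 3) = 2 * (2 ^ k * (2 * n + 3)) := fun k => by ring
  have key := eq_B_mul_add
    (F := fun k => coeff (2 ^ k * (2 * n + 3)) ((X * coreSeries 5) ^ 2))
    (S := fun k => coeff (2 ^ k * (2 * n + 3)) cuspSeries) ?_ ?_ ?_ ?_ k
  · have e0 : 2 ^ 0 * (2 * n + 3) = (2 * n + 1) + 2 := by ring
    have e1 : 2 ^ 1 * (2 * n + 3) = (4 * n + 4) + 2 := by ring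
    have ek : 2 ^ k * (2 * n + 3) = (2 ^ (k + 1) * n + 3 * 2 ^ k - 2) + 2 := by
      have : 1 ≤ 2 ^ k := Nat.one_le_two_pow
      rw [Nat.sub_add_cancel (by omega)]
      ring
    simpa only [e0, e1, ek, coeff_X_mul_coreSeries_sq] using key
  · simp only [pow_one, pow_zero, one_mul]
    rw [coeff_relation, hodd]
    ring
  · intro k
    rw [hstep (k + 1), coeff_relation, hexp]
  · simp only [pow_one, pow_zero, one_mul]
    rw [coeff_cuspSeries_relation, hodd]
    ring
  · intro k
    rw [hstep (k + 1), coeff_cuspSeries_relation, hexp]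

theorem ninetyone_mul_B (m : ℕ) :
    91 * B (4 * m + 3) = 8 ^ (4 * m + 4) - 1 ∧
      91 * B (4 * m + 4) = 8 ^ (4 * m + 5) - 1 + 448 * (-64) ^ m := by
  have hB : ∀ k, 7 * B (k + 2) = -28 * B (k + 1) - 56 * B k + (8 ^ (k + 2) - 1) := fun k => by
    have := seven_mul_div (k + 2)
    rw [B]
    linear_combination this
  induction m with
  | zero => norm_num [B]
  | succ m ih =>
    have h5 := hB (4 * m + 3)
    have h6 := hB (4 * m + 4)
    have h7 := hB (4 * m + 5)
    have h8 := hB (4 * m + 6)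
    obtain ⟨i1, i2⟩ := ih
    refine ⟨?_, ?_⟩
    · rw [show 4 * (m + 1) + 3 = 4 * m + 5 + 2 by ring]
      apply mul_left_cancel₀ (by norm_num : (7 : ℤ) ≠ 0)
      -- The weights 1, -4, 8 come from (x² + 4x + 8)(x² - 4x + 8) = x⁴ + 64: they relate `B` at
      -- indices four apart.
      linear_combination 91 * h7 - 4 * (91 * h6) + 8 * (91 * h5) - 448 * i1
    · rw [show 4 * (m + 1) + 4 = 4 * m + 6 + 2 by ring]
      apply mul_left_cancel₀ (by norm_num : (7 : ℤ) ≠ 0)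
      linear_combination 91 * h8 - 4 * (91 * h7) + 8 * (91 * h6) - 448 * i2

end CorePairs

theorem theorem1p2 :
    (∀ n k : ℕ, 1 ≤ k →
      (CorePairs.A 5 (2 ^ (k + 1) * n + 3 * 2 ^ k - 2) : ℤ) =
        CorePairs.B k * (CorePairs.A 5 (4 * n + 4) : ℤ) +
          ((8 ^ (k + 1) - 1) / 7 - 9 * CorePairs.B k) * (CorePairs.A 5 (2 * n + 1) : ℤ)) ∧
    (∀ m : ℕ, (91 : ℤ) ∣ 8 ^ (4 * m + 4) - 1 ∧
      CorePairs.B (4 * m + 3) = (8 ^ (4 * m + 4) - 1) / 91) ∧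
    (∀ m n : ℕ,
      (CorePairs.A 5 (2 ^ (4 * m + 4) * n + 3 * 2 ^ (4 * m + 3) - 2) : ℤ) ≡ 0
        [ZMOD (8 ^ (4 * m + 4) - 1) / 91]) := by
  have hB : ∀ m : ℕ, (8 ^ (4 * m + 4) - 1 : ℤ) / 91 = CorePairs.B (4 * m + 3) := fun m => by
    rw [← (CorePairs.ninetyone_mul_B m).1]
    exact Int.mul_ediv_cancel_left _ (by norm_num)
  refine ⟨fun n k _ => CorePairs.A_five_eq n k,
    fun m => ⟨⟨_, ((CorePairs.ninetyone_mul_B m).1).symm⟩, (hB m).symm⟩, fun m n => ?_⟩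
  rw [hB, Int.modEq_zero_iff_dvd, CorePairs.A_five_eq n (4 * m + 3)]
  -- Since 91 = 7 · 13, the second coefficient becomes (13 - 9) times `B (4 * m + 3)`, so both terms
  -- are multiples of it.
  have h : (8 ^ (4 * m + 3 + 1) - 1 : ℤ) / 7 = 13 * CorePairs.B (4 * m + 3) := by
    rw [← (CorePairs.ninetyone_mul_B m).1, show (91 : ℤ) = 7 * 13 by norm_num, mul_assoc]
    exact Int.mul_ediv_cancel_left _ (by norm_num)
  rw [h]
  exact ⟨CorePairs.A 5 (4 * n + 4) + 4 * CorePairs.A 5 (2 * n + 1), by ring⟩
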